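/- **Setting.** Let $V=(v_{ij})$ be a symmetric positive definite $2\times2$ matrix, $\mu\in\mathbb R^2$, and let $F$ be a probability distribution on $\mathbb R^2$ with a Lebesgue density of the form $f(x)=\det(V)^{-1/2}\,g\big((x-\mu)^TV^{-1}(x-\mu)\big)$ that is bounded in a neighbourhood of $\mu$. Let $V=U\,\mathrm{diag}(\lambda_1,\lambda_2)\,U^T$ with $U$ orthogonal and $\lambda_1\ge\lambda_2$, and put $a=\sqrt{v_{11}/v_{22}}$, $\rho=v_{12}/\sqrt{v_{11}v_{22}}$ and $V_0=\begin{pmatrix}a&\rho\\ \rho&a^{-1}\end{pmatrix}$. Let $X_1,X_2,\dots$ be i.i.d. with distribution $F$. Let $\hat\mu_n$ be a (measurable) spatial median of $X_1,\dots,X_n$, that is, a minimizer of $m\mapsto\sum_{i=1}^n\|X_i-m\|$. With the spatial sign $s(x)=x/\|x\|$ for $x\ne0$ and $s(0)=0$, let $\hat S_n=\frac1n\sum_{i=1}^n s(X_i-\hat\mu_n)s(X_i-\hat\mu_n)^T$ be the empirical spatial sign covariance matrix. Let $\hat S_n=\hat U_n\,\mathrm{diag}(\hat\delta_1,\hat\delta_2)\,\hat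 U_n^T$ be an eigenvalue decomposition, $\hat V_n=\hat U_n\,\mathrm{diag}(\hat\delta_1/\hat\delta_2,\ \hat\delta_2/\hat\delta_1)\,\hat U_n^T$ and $\hat V_{0,n}=(\hat v_{11}\hat v_{22})^{-1/2}\,\hat V_n$, with entries $\hat v_{0,ij}$ (with any value, say $0$, where a denominator vanishes). **Proposition.** As $n\to\infty$: (1) $\hat V_{0,n}\to V_0$ almost surely. (2) $\sqrt n\,\big\{(\hat v_{0,11},\hat v_{0,12})^T-(a,\rho)^T\big\}\to N_2(0,\;G\,W_S\,G^T)$ in distribution. Here $G\,W_S\,G^T$ is positive semidefinite, with $$W_S=\frac{-\lambda_1\lambda_2+\frac12\sqrt{\lambda_1\lambda_2}\,(\lambda_1+\lambda_2)}{(\lambda_1-\lambda_2)^2}\,(U\otimes U)\begin{pmatrix}1&0&0&-1\\0&1&1&0\\0&1&1&0\\-1&0&0&1\end{pmatrix}(U\otimes U)^T,$$ $$G=\frac{(a^2+1)\sqrt{1-\rho^2}+2a(1-\rho^2)}{\sqrt{1-\rho^2}\,\big(4a^2\rho^2+(a^2-1)^2\big)}\begin{pmatrix}g_{11}&g_{12}&0&0\\g_{21}&g_{22}&0&0\end{pmatrix},$$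 $$\begin{aligned} g_{11}&=(a^2-1)^2\sqrt{1-\rho^2}+2a(a^2+1)\rho^2,\\ g_{12}&=(a^2-1)\,\rho\,\big\{2a\sqrt{1-\rho^2}-a^2-1\big\},\\ g_{21}&=a^{-1}(a^2-1)\,\rho\,\big\{(a^2+1)\sqrt{1-\rho^2}-2a(1-\rho^2)\big\},\\ g_{22}&=2(a^2+1)\rho^2\sqrt{1-\rho^2}+a^{-1}(a^2-1)^2(1-\rho^2). \end{aligned}$$ In the spherical case $\lambda_1=\lambda_2$ (equivalently $a=1$, $\rho=0$), where these expressions read $0/0$, they are replaced by their limits: the scalar factor of $W_S$ is $\frac18$, and $G=\begin{pmatrix}4&0&0&0\\0&4&0&0\end{pmatrix}$. Moreover, let $J$ be the map $(a,\rho)\mapsto(s_{11},s_{12})$, where $(s_{ij})=Q\,\mathrm{diag}(\delta_1,\delta_2)\,Q^T$, $\delta_j=\sqrt{\ell_j}/(\sqrt{\ell_1}+\sqrt{\ell_2})$, for an eigenvalue decomposition $Q\,\mathrm{diag}(\ell_1,\ell_2)\,Q^T$ of $\begin{pmatrix}a&\rho\\ \rho&a^{-1}\end{pmatrix}$. Then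 $J(a,\rho)$ consists of the entries $(1,1)$ and $(1,2)$ of $S(F)=\mathbb E\{s(X_1-\mu)s(X_1-\mu)^T\}$, $J$ is differentiable at $(a,\rho)$, and the first two columns of $G$ form the inverse of its Jacobian matrix there. -/

import Mathlib

open MeasureTheory ProbabilityTheory Filter Topology
open scoped Kronecker

noncomputable section

namespace SSCM

/-- Euclidean space `ℝᵖ`. -/
abbrev Vec (p : ℕ) : Type := EuclideanSpace ℝ (Fin p)

/-! ### Elliptical distributions -/

/-- The elliptical density
`x ↦ det(V)^(-1/2) g((x - μ)ᵀ V⁻¹ (x - μ))` with location `μ`, shape `V` and generator `g`. -/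
def ellipticalDensity {p : ℕ} (μ : Vec p) (V : Matrix (Fin p) (Fin p) ℝ) (g : ℝ → ℝ)
    (x : Vec p) : ℝ :=
  (Real.sqrt V.det)⁻¹ * g ((x - μ).ofLp ⬝ᵥ V⁻¹.mulVec (x - μ).ofLp)

/-- `F` is the continuous elliptical distribution with location `μ`, (symmetric, positive definite)
shape matrix `V` and generator `g : [0, ∞) → [0, ∞)`. -/
structure IsElliptical {p : ℕ} (F : Measure (Vec p)) (μ : Vec p)
    (V : Matrix (Fin p) (Fin p) ℝ) (g : ℝ → ℝ) : Prop where
  posDef : V.PosDef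
  measurable_generator : Measurable g
  generator_nonneg : ∀ t, 0 ≤ t → 0 ≤ g t
  isProbabilityMeasure : IsProbabilityMeasure F
  eq_withDensity :
    F = (volume : Measure (Vec p)).withDensity
      (fun x => ENNReal.ofReal (ellipticalDensity μ V g x))

/-! ### Spatial signs, spatial median, spatial sign covariance matrix -/

/-- The spatial sign `x / ‖x‖` for `x ≠ 0`, and `0` for `x = 0`. -/
def spatialSign {p : ℕ} (x : Vec p) : Vec p := ‖x‖⁻¹ • x

/-- The rank one matrix `s(x) s(x)ᵀ`. -/
def signOuter {p : ℕ} (x : Vec p) : Matrix (Fin p) (Fin p) ℝ :=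
  Matrix.vecMulVec (spatialSign x).ofLp (spatialSign x).ofLp

/-- `m` is a spatial median of the finite sample `x 0, …, x (n - 1)`: it minimizes the sum of the
Euclidean distances to the observations. -/
def IsSpatialMedian {p : ℕ} (n : ℕ) (x : ℕ → Vec p) (m : Vec p) : Prop :=
  ∀ y : Vec p, ∑ i ∈ Finset.range n, ‖x i - m‖ ≤ ∑ i ∈ Finset.range n, ‖x i - y‖

/-- The population spatial sign covariance matrix of `F` with respect to the centre `t`. -/
def sscm {p : ℕ} (F : Measure (Vec p)) (t : Vec p) : Matrix (Fin p) (Fin p) ℝ :=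
  Matrix.of fun i j => ∫ x, signOuter (x - t) i j ∂F

/-- The empirical spatial sign covariance matrix of `x 0, …, x (n - 1)` with respect to the
centre `t`. -/
def empSSCM {p : ℕ} (n : ℕ) (x : ℕ → Vec p) (t : Vec p) : Matrix (Fin p) (Fin p) ℝ :=
  (n : ℝ)⁻¹ • ∑ i ∈ Finset.range n, signOuter (x i - t)

theorem isHermitian_empSSCM {p : ℕ} (n : ℕ) (x : ℕ → Vec p) (t : Vec p) :
    (empSSCM n x t).IsHermitian := by
  ext i j
  simp [empSSCM, signOuter, Matrix.vecMulVec_apply, Matrix.sum_apply, mul_comm]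

/-! ### Shape matrices in dimension two -/

/-- `U diag(d₁, d₂) Uᵀ`, where the columns of the orthogonal matrix `U` are the eigenvectors of the
symmetric matrix `A`, in the order of `hA.eigenvalues`. -/
def withEigenvalues {A : Matrix (Fin 2) (Fin 2) ℝ} (hA : A.IsHermitian) (d : Fin 2 → ℝ) :
    Matrix (Fin 2) (Fin 2) ℝ :=
  (hA.eigenvectorUnitary : Matrix (Fin 2) (Fin 2) ℝ) * Matrix.diagonal d *
    (hA.eigenvectorUnitary : Matrix (Fin 2) (Fin 2) ℝ).transpose

/-- The shape matrix `U diag(δ₁/δ₂, δ₂/δ₁) Uᵀ` reconstructed from `S = U diag(δ₁, δ₂) Uᵀ`.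
It depends neither on the order of the eigenvalues nor on the choice of the eigenvectors. -/
def shapeOfSSCM {S : Matrix (Fin 2) (Fin 2) ℝ} (hS : S.IsHermitian) :
    Matrix (Fin 2) (Fin 2) ℝ :=
  withEigenvalues hS
    ![hS.eigenvalues 0 / hS.eigenvalues 1, hS.eigenvalues 1 / hS.eigenvalues 0]

/-- The matrix `U diag(δ₁, δ₂) Uᵀ` with `δⱼ = √λⱼ / (√λ₁ + √λ₂)`, for `V = U diag(λ₁, λ₂) Uᵀ`. -/
def sscmOfShape {V : Matrix (Fin 2) (Fin 2) ℝ} (hV : V.IsHermitian) :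
    Matrix (Fin 2) (Fin 2) ℝ :=
  withEigenvalues hV fun j =>
    Real.sqrt (hV.eigenvalues j) /
      (Real.sqrt (hV.eigenvalues 0) + Real.sqrt (hV.eigenvalues 1))

/-- Rescaling of a matrix such that the product of its diagonal elements becomes `1`. -/
def diagNormalize (V : Matrix (Fin 2) (Fin 2) ℝ) : Matrix (Fin 2) (Fin 2) ℝ :=
  (Real.sqrt (V 0 0 * V 1 1))⁻¹ • V

/-- The estimator `V̂ₙ`, computed from the observations `x 0, …, x (n - 1)` and the centre `t`. -/
def shapeEst (n : ℕ) (x : ℕ → Vec 2) (t : Vec 2) : Matrix (Fin 2) (Fin 2) ℝ :=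
  shapeOfSSCM (isHermitian_empSSCM n x t)

/-- The estimator `V̂₀,ₙ`, the diagonal-normalized version of `V̂ₙ`. -/
def shapeEst₀ (n : ℕ) (x : ℕ → Vec 2) (t : Vec 2) : Matrix (Fin 2) (Fin 2) ℝ :=
  diagNormalize (shapeEst n x t)

/-- The parameter `a = √(v₁₁ / v₂₂)`. -/
def ratio (V : Matrix (Fin 2) (Fin 2) ℝ) : ℝ := Real.sqrt (V 0 0 / V 1 1)

/-- The generalized correlation coefficient `ρ = v₁₂ / √(v₁₁ v₂₂)`. -/
def corr (V : Matrix (Fin 2) (Fin 2) ℝ) : ℝ := V 0 1 / Real.sqrt (V 0 0 * V 1 1)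

/-- The shape matrix with reciprocal diagonal elements `a`, `a⁻¹` and correlation `ρ`. -/
def shape₀ (a ρ : ℝ) : Matrix (Fin 2) (Fin 2) ℝ := !![a, ρ; ρ, a⁻¹]

theorem isHermitian_shape₀ (a ρ : ℝ) : (shape₀ a ρ).IsHermitian := by
  ext i j
  fin_cases i <;> fin_cases j <;> simp [shape₀]

/-- The map `(a, ρ) ↦ (s₁₁, s₁₂)` from the parameters of the shape matrix to the elements of the
spatial sign covariance matrix. -/
def paramToSSCM (θ : Fin 2 → ℝ) : Fin 2 → ℝ :=
  ![sscmOfShape (isHermitian_shape₀ (θ 0) (θ 1)) 0 0,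
    sscmOfShape (isHermitian_shape₀ (θ 0) (θ 1)) 0 1]

/-! ### The asymptotic covariance matrices -/

/-- The scalar factor of `W_S`. At `l₁ = l₂`, where the formula reads `0 / 0`, it is continued by
its limit `1 / 8`. -/
def wCoeff (l₁ l₂ : ℝ) : ℝ :=
  if l₁ = l₂ then 1 / 8
  else (-(l₁ * l₂) + 1 / 2 * Real.sqrt (l₁ * l₂) * (l₁ + l₂)) / (l₁ - l₂) ^ 2

/-- The matrix `W₀`. -/
def W₀ : Matrix (Fin 4) (Fin 4) ℝ :=
  !![ 1, 0, 0, -1;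
      0, 1, 1,  0;
      0, 1, 1,  0;
     -1, 0, 0,  1]

/-- The Kronecker product `U ⊗ U` as a `4 × 4` matrix, in the usual (lexicographic) order. -/
def kronSq (U : Matrix (Fin 2) (Fin 2) ℝ) : Matrix (Fin 4) (Fin 4) ℝ :=
  Matrix.reindex (finProdFinEquiv (m := 2) (n := 2)) (finProdFinEquiv (m := 2) (n := 2)) (U ⊗ₖ U)

/-- The asymptotic covariance matrix `W_S` of `vec Ŝₙ`, for the shape `U diag(l₁, l₂) Uᵀ`. -/
def WS (U : Matrix (Fin 2) (Fin 2) ℝ) (l₁ l₂ : ℝ) : Matrix (Fin 4) (Fin 4) ℝ :=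
  wCoeff l₁ l₂ • (kronSq U * W₀ * (kronSq U).transpose)

/-- The `2 × 4` matrix `G`. At `a = 1`, `ρ = 0`, where the formula reads `0 / 0`, it is continued by
its limit. -/
def G (a ρ : ℝ) : Matrix (Fin 2) (Fin 4) ℝ :=
  if a = 1 ∧ ρ = 0 then !![4, 0, 0, 0; 0, 4, 0, 0]
  else
    (((a ^ 2 + 1) * Real.sqrt (1 - ρ ^ 2) + 2 * a * (1 - ρ ^ 2)) /
      (Real.sqrt (1 - ρ ^ 2) * (4 * a ^ 2 * ρ ^ 2 + (a ^ 2 - 1) ^ 2))) •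
    !![(a ^ 2 - 1) ^ 2 * Real.sqrt (1 - ρ ^ 2) + 2 * a * (a ^ 2 + 1) * ρ ^ 2,
        (a - 1) * (a + 1) * ρ * (2 * a * Real.sqrt (1 - ρ ^ 2) - a ^ 2 - 1), 0, 0;
       a⁻¹ * (a - 1) * (a + 1) * ρ *
          ((a ^ 2 + 1) * Real.sqrt (1 - ρ ^ 2) - 2 * a * (1 - ρ ^ 2)),
        2 * (a ^ 2 + 1) * ρ ^ 2 * Real.sqrt (1 - ρ ^ 2) +
          a⁻¹ * (a ^ 2 - 1) ^ 2 * (1 - ρ ^ 2), 0, 0]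

/-- The asymptotic covariance matrix `W_{V₀} = G W_S Gᵀ`. -/
def WV₀ (a ρ : ℝ) (U : Matrix (Fin 2) (Fin 2) ℝ) (l₁ l₂ : ℝ) : Matrix (Fin 2) (Fin 2) ℝ :=
  G a ρ * WS U l₁ l₂ * (G a ρ).transpose

end SSCM

end

/-!
Identify `ℝ²` with `ℂ`. The matrix `s(w) s(w)ᵀ` is an affine image of the doubled direction
`q = w² / |w|²`, so the empirical spatial sign covariance matrix is an affine image of the average
of the doubled directions of the sample, and the shape estimator is a smooth function of that
average.

A centred elliptical law is the image of a spherical one under a real linear map of `ℂ`. On a circle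
centred at `0`, the doubled direction of such a map is a Möbius transformation of the doubled
direction of its argument, so by the mean value property the means of its powers are the powers of
its mean `m`. This makes both `m` and the covariance of the doubled direction explicit.

By convexity of its objective function, the spatial median deviates from `μ` at most by a constant
times the average direction, which vanishes almost surely and is of order `n ^ (-1 / 2)` in mean
square. Recentring at the median changes the average of the doubled directions only by a little-o of
this: the derivative with respect to the centre has mean zero by central symmetry, and boundedness
of the density controls the observations near the centre. Hence the estimator has the same limit law
as the one centred at `μ`, which is given by the central limit theorem and the delta method.

The covariance matrix of the limit is identified through `S = (V + √det V I) / (tr V + 2 √det V)`,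
which makes the map `(a, ρ) ↦ (s₁₁, s₁₂)` rational in `a`, `ρ` and `√(1 - ρ²)`.
-/

noncomputable section

namespace SSCM

open scoped ComplexConjugate

section Spectral

variable {A : Matrix (Fin 2) (Fin 2) ℝ}

theorem withEigenvalues_eq_conjStarAlgAut (hA : A.IsHermitian) (d : Fin 2 → ℝ) :
    withEigenvalues hA d =
      Unitary.conjStarAlgAut ℝ _ hA.eigenvectorUnitary (Matrix.diagonal d) := by
  rw [withEigenvalues, Unitary.conjStarAlgAut_apply, Matrix.star_eq_conjTranspose,
    Matrix.conjTranspose_eq_transpose_of_trivial]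

theorem withEigenvalues_eigenvalues (hA : A.IsHermitian) :
    withEigenvalues hA hA.eigenvalues = A := by
  rw [withEigenvalues_eq_conjStarAlgAut]
  exact hA.spectral_theorem.symm

theorem withEigenvalues_mul (hA : A.IsHermitian) (d e : Fin 2 → ℝ) :
    withEigenvalues hA (d * e) = withEigenvalues hA d * withEigenvalues hA e := by
  simp only [withEigenvalues_eq_conjStarAlgAut, ← map_mul, Matrix.diagonal_mul_diagonal, Pi.mul_def]

theorem withEigenvalues_smul (hA : A.IsHermitian) (c : ℝ) (d : Fin 2 → ℝ) :
    withEigenvalues hA (c • d) = c • withEigenvalues hA d := by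
  simp only [withEigenvalues_eq_conjStarAlgAut, ← map_smul, Matrix.diagonal_smul]

theorem withEigenvalues_add_const (hA : A.IsHermitian) (d : Fin 2 → ℝ) (c : ℝ) :
    withEigenvalues hA (fun i => d i + c) = withEigenvalues hA d + c • 1 := by
  rw [← map_one (Unitary.conjStarAlgAut ℝ _ hA.eigenvectorUnitary)]
  simp only [withEigenvalues_eq_conjStarAlgAut, ← map_smul, ← map_add, Matrix.smul_one_eq_diagonal,
    Matrix.diagonal_add]

theorem eigenvalues_mul_eq_det (hA : A.IsHermitian) :
    hA.eigenvalues 0 * hA.eigenvalues 1 = A.det := by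
  simpa using hA.det_eq_prod_eigenvalues.symm

theorem eigenvalues_add_eq_trace (hA : A.IsHermitian) :
    hA.eigenvalues 0 + hA.eigenvalues 1 = A.trace := by
  simpa using hA.trace_eq_sum_eigenvalues.symm

theorem pos_and_pos_of_mul_pos_of_add_pos {x y : ℝ} (hmul : 0 < x * y) (hadd : 0 < x + y) :
    0 < x ∧ 0 < y := by
  rcases mul_pos_iff.1 hmul with h | h
  · exact h
  · linarith [h.1, h.2]

theorem posDef_of_det_pos_of_trace_pos (hA : A.IsHermitian) (hdet : 0 < A.det)
    (htr : 0 < A.trace) : A.PosDef := by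
  rw [← eigenvalues_mul_eq_det hA] at hdet
  rw [← eigenvalues_add_eq_trace hA] at htr
  exact hA.posDef_iff_eigenvalues_pos.2
    (Fin.forall_fin_two.2 (pos_and_pos_of_mul_pos_of_add_pos hdet htr))

theorem shapeOfSSCM_eq (hA : A.IsHermitian) : shapeOfSSCM hA = A.det⁻¹ • (A * A) := by
  have div_eq (x y : ℝ) : x / y = (x * y)⁻¹ * (x * x) := by
    rcases eq_or_ne x 0 with rfl | hx
    · simp
    · rw [mul_inv, mul_comm x⁻¹, mul_assoc, inv_mul_cancel_left₀ hx, div_eq_inv_mul]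
  have h : ![hA.eigenvalues 0 / hA.eigenvalues 1, hA.eigenvalues 1 / hA.eigenvalues 0]
      = A.det⁻¹ • (hA.eigenvalues * hA.eigenvalues) := by
    rw [← eigenvalues_mul_eq_det hA]
    ext i
    fin_cases i
    · exact div_eq _ _
    · rw [mul_comm (hA.eigenvalues 0)]
      exact div_eq _ _
  rw [shapeOfSSCM, h, withEigenvalues_smul, withEigenvalues_mul, withEigenvalues_eigenvalues]

theorem sqrt_div_sqrt_add_sqrt {x y : ℝ} (hx : 0 < x) (hy : 0 < y) :
    √x / (√x + √y) = (x + y + 2 * √(x * y))⁻¹ * (x + √(x * y)) := by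
  have := Real.sqrt_pos.2 hx
  have := Real.sqrt_pos.2 hy
  have hnum : x + √(x * y) = √x * (√x + √y) := by
    rw [Real.sqrt_mul hx.le, mul_add, Real.mul_self_sqrt hx.le]
  have hden : x + y + 2 * √(x * y) = (√x + √y) * (√x + √y) := by
    linear_combination 2 * Real.sqrt_mul hx.le y - Real.sq_sqrt hx.le - Real.sq_sqrt hy.le
  rw [hnum, hden]
  field_simp

theorem sscmOfShape_eq (hA : A.PosDef) :
    sscmOfShape hA.1 = (A.trace + 2 * √A.det)⁻¹ • (A + √A.det • 1) := by
  have h₀ := hA.eigenvalues_pos 0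
  have h₁ := hA.eigenvalues_pos 1
  have h : (fun j => √(hA.1.eigenvalues j) / (√(hA.1.eigenvalues 0) + √(hA.1.eigenvalues 1)))
      = (A.trace + 2 * √A.det)⁻¹ • fun j => hA.1.eigenvalues j + √A.det := by
    rw [← eigenvalues_mul_eq_det hA.1, ← eigenvalues_add_eq_trace hA.1]
    ext j
    fin_cases j
    · exact sqrt_div_sqrt_add_sqrt h₀ h₁
    · rw [add_comm √_, add_comm (hA.1.eigenvalues 0), mul_comm (hA.1.eigenvalues 0)]
      exact sqrt_div_sqrt_add_sqrt h₁ h₀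
  rw [sscmOfShape, h, withEigenvalues_smul, withEigenvalues_add_const,
    withEigenvalues_eigenvalues]

end Spectral

/-! ### Symmetric matrices as pairs of a trace and a doubled-angle vector -/

/-- The symmetric matrix with trace `e` and doubled-angle vector `q`, that is, with
`q = s₁₁ - s₂₂ + 2 i s₁₂`. -/
def symMatrix (e : ℝ) (q : ℂ) : Matrix (Fin 2) (Fin 2) ℝ :=
  !![(e + q.re) / 2, q.im / 2; q.im / 2, (e - q.re) / 2]

theorem re_sq_add_im_sq (q : ℂ) : q.re ^ 2 + q.im ^ 2 = ‖q‖ ^ 2 := by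
  rw [← Complex.normSq_eq_norm_sq, Complex.normSq_apply, sq, sq]

theorem det_symMatrix (e : ℝ) (q : ℂ) : (symMatrix e q).det = (e ^ 2 - ‖q‖ ^ 2) / 4 := by
  rw [symMatrix, Matrix.det_fin_two_of]
  linear_combination -re_sq_add_im_sq q / 4

theorem symMatrix_smul (c e : ℝ) (q : ℂ) : symMatrix (c * e) (c * q) = c • symMatrix e q := by
  ext i j
  fin_cases i <;> fin_cases j <;> simp [symMatrix] <;> ring

theorem symMatrix_mul_self (q : ℂ) :
    symMatrix 1 q * symMatrix 1 q =
      (4⁻¹ : ℝ) • !![‖1 + q‖ ^ 2, 2 * q.im; 2 * q.im, ‖1 - q‖ ^ 2] := by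
  simp only [← re_sq_add_im_sq]
  ext i j
  fin_cases i <;> fin_cases j <;>
    simp [symMatrix, Matrix.mul_apply, Fin.sum_univ_two] <;> ring

theorem diagNormalize_smul {c : ℝ} (hc : 0 < c) (V : Matrix (Fin 2) (Fin 2) ℝ) :
    diagNormalize (c • V) = diagNormalize V := by
  have h : √((c • V) 0 0 * (c • V) 1 1) = c * √(V 0 0 * V 1 1) := by
    simp only [Matrix.smul_apply, smul_eq_mul]
    rw [mul_mul_mul_comm, Real.sqrt_mul (mul_self_nonneg c), Real.sqrt_mul_self hc.le]
  rw [diagNormalize, diagNormalize, h, smul_smul, mul_inv, mul_right_comm,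
    inv_mul_cancel₀ hc.ne', one_mul]

theorem diagNormalize_shapeOfSSCM {S : Matrix (Fin 2) (Fin 2) ℝ} (hS : S.IsHermitian)
    (hdet : 0 < S.det) : diagNormalize (shapeOfSSCM hS) = diagNormalize (S * S) := by
  rw [shapeOfSSCM_eq, diagNormalize_smul (inv_pos.2 hdet)]

/-- The parameters `(a, ρ)` of the shape matrix, as a function of the doubled-angle vector of the
spatial sign covariance matrix. -/
def dirSqToParam (q : ℂ) : Vec 2 :=
  !₂[‖1 + q‖ / ‖1 - q‖, 2 * q.im / (‖1 + q‖ * ‖1 - q‖)]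

theorem one_add_ne_zero_of_norm_lt_one {q : ℂ} (hq : ‖q‖ < 1) : 1 + q ≠ 0 := by
  intro h
  rw [← neg_eq_of_add_eq_zero_right h, norm_neg, norm_one] at hq
  exact hq.false

theorem one_sub_ne_zero_of_norm_lt_one {q : ℂ} (hq : ‖q‖ < 1) : 1 - q ≠ 0 := by
  rw [sub_eq_add_neg]
  exact one_add_ne_zero_of_norm_lt_one (by rwa [norm_neg])

theorem diagNormalize_symMatrix_mul_self {q : ℂ} (hq : ‖q‖ < 1) :
    diagNormalize (symMatrix 1 q * symMatrix 1 q) =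
      shape₀ (dirSqToParam q 0) (dirSqToParam q 1) := by
  have h₁ : 0 < ‖1 + q‖ := norm_pos_iff.2 (one_add_ne_zero_of_norm_lt_one hq)
  have h₂ : 0 < ‖1 - q‖ := norm_pos_iff.2 (one_sub_ne_zero_of_norm_lt_one hq)
  have hsqrt : √(‖1 + q‖ ^ 2 * ‖1 - q‖ ^ 2) = ‖1 + q‖ * ‖1 - q‖ := by
    rw [← mul_pow, Real.sqrt_sq (by positivity)]
  rw [symMatrix_mul_self, diagNormalize_smul (by norm_num)]
  ext i j
  fin_cases i <;> fin_cases j <;>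
    simp [diagNormalize, shape₀, dirSqToParam, hsqrt] <;> field_simp

theorem diagNormalize_shapeOfSSCM_symMatrix {e : ℝ} {q : ℂ} (hq : ‖q‖ < e)
    {S : Matrix (Fin 2) (Fin 2) ℝ} (hS : S.IsHermitian) (hSq : S = symMatrix e q) :
    diagNormalize (shapeOfSSCM hS) =
      shape₀ (dirSqToParam (q / e) 0) (dirSqToParam (q / e) 1) := by
  have he : 0 < e := (norm_nonneg q).trans_lt hq
  have hdet : 0 < S.det := by
    rw [hSq, det_symMatrix]
    linarith [pow_lt_pow_left₀ hq (norm_nonneg q) two_ne_zero]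
  have hscale : S = e • symMatrix 1 (q / e) := by
    rw [hSq, ← symMatrix_smul, mul_one, mul_div_cancel₀ _ (Complex.ofReal_ne_zero.2 he.ne')]
  have hlt : ‖q / e‖ < 1 := by
    rwa [norm_div, Complex.norm_of_nonneg he.le, div_lt_one he]
  rw [diagNormalize_shapeOfSSCM hS hdet, hscale, Matrix.smul_mul, Matrix.mul_smul, smul_smul,
    diagNormalize_smul (mul_pos he he), diagNormalize_symMatrix_mul_self hlt]

/-! ### Positive definite shape matrices -/

section PosDef

variable {V : Matrix (Fin 2) (Fin 2) ℝ}

theorem apply_one_zero_of_posDef (hV : V.PosDef) : V 1 0 = V 0 1 := by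
  simpa using hV.1.apply 0 1

theorem trace_add_two_mul_sqrt_det_pos (hV : V.PosDef) : 0 < V.trace + 2 * √V.det :=
  add_pos_of_pos_of_nonneg hV.trace_pos (by positivity)

/-- The doubled-angle vector of the spatial sign covariance matrix of an elliptical distribution
with shape `V`. -/
def meanDirSq (V : Matrix (Fin 2) (Fin 2) ℝ) : ℂ :=
  ⟨(V 0 0 - V 1 1) / (V.trace + 2 * √V.det), 2 * V 0 1 / (V.trace + 2 * √V.det)⟩

theorem symMatrix_meanDirSq (hV : V.PosDef) :
    symMatrix 1 (meanDirSq V) = (V.trace + 2 * √V.det)⁻¹ • (V + √V.det • 1) := by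
  have hN := trace_add_two_mul_sqrt_det_pos hV
  rw [Matrix.trace_fin_two] at hN
  ext i j
  fin_cases i <;> fin_cases j <;>
    simp [symMatrix, meanDirSq, Matrix.trace_fin_two, apply_one_zero_of_posDef hV] <;>
    field_simp <;> ring

theorem sscmOfShape_eq_symMatrix (hV : V.PosDef) :
    sscmOfShape hV.1 = symMatrix 1 (meanDirSq V) := by
  rw [sscmOfShape_eq hV, symMatrix_meanDirSq hV]

theorem one_sub_norm_meanDirSq_sq (hV : V.PosDef) :
    1 - ‖meanDirSq V‖ ^ 2 = 4 * √V.det / (V.trace + 2 * √V.det) := by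
  have hN := trace_add_two_mul_sqrt_det_pos hV
  have hdet : √V.det ^ 2 = V 0 0 * V 1 1 - V 0 1 ^ 2 := by
    rw [Real.sq_sqrt hV.det_pos.le, Matrix.det_fin_two, apply_one_zero_of_posDef hV, sq]
  rw [← re_sq_add_im_sq, meanDirSq]
  rw [Matrix.trace_fin_two] at *
  field_simp
  linear_combination (-4) * hdet

theorem norm_meanDirSq_lt_one (hV : V.PosDef) : ‖meanDirSq V‖ < 1 := by
  have h : 0 < 1 - ‖meanDirSq V‖ ^ 2 := by
    rw [one_sub_norm_meanDirSq_sq hV]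
    exact div_pos (mul_pos four_pos (Real.sqrt_pos.2 hV.det_pos))
      (trace_add_two_mul_sqrt_det_pos hV)
  nlinarith [norm_nonneg (meanDirSq V)]

theorem diagNormalize_eq_shape₀ (hV : V.PosDef) : diagNormalize V = shape₀ (ratio V) (corr V) := by
  have h₀ : 0 < V 0 0 := hV.diag_pos
  have h₁ : 0 < V 1 1 := hV.diag_pos
  have := Real.sqrt_pos.2 h₀
  have := Real.sqrt_pos.2 h₁
  have e₀ := Real.sq_sqrt h₀.le
  have e₁ := Real.sq_sqrt h₁.le
  ext i j
  fin_cases i <;> fin_cases j <;>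
    simp [diagNormalize, shape₀, ratio, corr, Real.sqrt_mul h₀.le, Real.sqrt_div h₀.le,
      apply_one_zero_of_posDef hV] <;> field_simp <;> simp only [e₀, e₁]

theorem ratio_pos (hV : V.PosDef) : 0 < ratio V :=
  Real.sqrt_pos.2 (div_pos hV.diag_pos hV.diag_pos)

theorem corr_sq_lt_one (hV : V.PosDef) : corr V ^ 2 < 1 := by
  have h₀ : 0 < V 0 0 * V 1 1 := mul_pos hV.diag_pos hV.diag_pos
  have hdet := hV.det_pos
  rw [Matrix.det_fin_two, apply_one_zero_of_posDef hV] at hdet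
  rw [corr, div_pow, Real.sq_sqrt h₀.le, div_lt_one h₀]
  linarith

theorem mul_self_eq_trace_smul_sub_det_smul (A : Matrix (Fin 2) (Fin 2) ℝ) :
    A * A = A.trace • A - A.det • 1 := by
  ext i j
  fin_cases i <;> fin_cases j <;>
    simp [Matrix.mul_apply, Fin.sum_univ_two, Matrix.trace_fin_two, Matrix.det_fin_two] <;> ring

theorem add_sqrt_det_smul_one_mul_self (hV : V.PosDef) :
    (V + √V.det • 1) * (V + √V.det • 1) = (V.trace + 2 * √V.det) • V := by
  have h : √V.det * √V.det = V.det := Real.mul_self_sqrt hV.det_pos.le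
  simp only [add_mul, mul_add, mul_self_eq_trace_smul_sub_det_smul, smul_mul_assoc, mul_smul_comm,
    mul_one, one_mul]
  linear_combination (norm := module) h • (1 : Matrix (Fin 2) (Fin 2) ℝ)

theorem shape₀_dirSqToParam_meanDirSq (hV : V.PosDef) :
    shape₀ (dirSqToParam (meanDirSq V) 0) (dirSqToParam (meanDirSq V) 1) =
      shape₀ (ratio V) (corr V) := by
  have hN := trace_add_two_mul_sqrt_det_pos hV
  rw [← diagNormalize_symMatrix_mul_self (norm_meanDirSq_lt_one hV), symMatrix_meanDirSq hV,
    smul_mul_smul_comm, add_sqrt_det_smul_one_mul_self hV, smul_smul,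
    diagNormalize_smul (by positivity), diagNormalize_eq_shape₀ hV]

theorem dirSqToParam_meanDirSq (hV : V.PosDef) :
    dirSqToParam (meanDirSq V) = !₂[ratio V, corr V] := by
  have h := shape₀_dirSqToParam_meanDirSq hV
  ext i
  fin_cases i
  · simpa [shape₀] using congrFun₂ h 0 0
  · simpa [shape₀] using congrFun₂ h 0 1

theorem det_shape₀ {a : ℝ} (ha : a ≠ 0) (ρ : ℝ) : (shape₀ a ρ).det = 1 - ρ ^ 2 := by
  rw [shape₀, Matrix.det_fin_two_of, mul_inv_cancel₀ ha, sq]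

theorem trace_shape₀ (a ρ : ℝ) : (shape₀ a ρ).trace = a + a⁻¹ := by
  simp [shape₀, Matrix.trace_fin_two]

theorem posDef_shape₀ {a ρ : ℝ} (ha : 0 < a) (hρ : ρ ^ 2 < 1) : (shape₀ a ρ).PosDef := by
  refine posDef_of_det_pos_of_trace_pos (isHermitian_shape₀ a ρ) ?_ ?_
  · rw [det_shape₀ ha.ne']
    linarith
  · rw [trace_shape₀]
    positivity

theorem ratio_shape₀ {a : ℝ} (ha : 0 ≤ a) (ρ : ℝ) : ratio (shape₀ a ρ) = a := by
  simp [ratio, shape₀, Real.sqrt_mul_self ha]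

theorem corr_shape₀ {a : ℝ} (ha : a ≠ 0) (ρ : ℝ) : corr (shape₀ a ρ) = ρ := by
  simp [corr, shape₀, ha]

theorem meanDirSq_smul {c : ℝ} (hc : 0 < c) (V : Matrix (Fin 2) (Fin 2) ℝ) :
    meanDirSq (c • V) = meanDirSq V := by
  have hN : (c • V).trace + 2 * √(c • V).det = c * (V.trace + 2 * √V.det) := by
    rw [Matrix.trace_smul, Matrix.det_smul, Fintype.card_fin, Real.sqrt_mul (sq_nonneg c),
      Real.sqrt_sq hc.le, smul_eq_mul]
    ring
  apply Complex.ext <;> simp only [meanDirSq, hN, Matrix.smul_apply, smul_eq_mul]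
  · rw [← mul_sub, mul_div_mul_left _ _ hc.ne']
  · rw [mul_left_comm, mul_div_mul_left _ _ hc.ne']

theorem meanDirSq_shape₀_ratio_corr (hV : V.PosDef) :
    meanDirSq (shape₀ (ratio V) (corr V)) = meanDirSq V := by
  rw [← diagNormalize_eq_shape₀ hV, diagNormalize]
  exact meanDirSq_smul (inv_pos.2 (Real.sqrt_pos.2 (mul_pos hV.diag_pos hV.diag_pos))) V

theorem paramToSSCM_eq_meanDirSq {θ : Fin 2 → ℝ} (ha : 0 < θ 0) (hρ : θ 1 ^ 2 < 1) :
    paramToSSCM θ = ![(1 + (meanDirSq (shape₀ (θ 0) (θ 1))).re) / 2,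
      (meanDirSq (shape₀ (θ 0) (θ 1))).im / 2] := by
  rw [paramToSSCM, sscmOfShape_eq_symMatrix (posDef_shape₀ ha hρ)]
  rfl

theorem paramToSSCM_ratio_corr (hV : V.PosDef) :
    paramToSSCM ![ratio V, corr V] = ![(1 + (meanDirSq V).re) / 2, (meanDirSq V).im / 2] := by
  rw [← meanDirSq_shape₀_ratio_corr hV]
  exact paramToSSCM_eq_meanDirSq (ratio_pos hV) (corr_sq_lt_one hV)

end PosDef

/-! ### The Jacobian matrix of `paramToSSCM` -/

/-- The Jacobian matrix of `paramToSSCM` at `(a, ρ)`. -/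
def jacobian (a ρ : ℝ) : Matrix (Fin 2) (Fin 2) ℝ :=
  ((a + a⁻¹ + 2 * √(1 - ρ ^ 2)) ^ 2)⁻¹ •
    !![2 * a⁻¹ + √(1 - ρ ^ 2) * (1 + a⁻¹ ^ 2), (a - a⁻¹) * ρ / √(1 - ρ ^ 2);
      -(ρ * (1 - a⁻¹ ^ 2)), a + a⁻¹ + 2 / √(1 - ρ ^ 2)]

theorem paramToSSCM_eq {θ : Fin 2 → ℝ} (ha : 0 < θ 0) (hρ : θ 1 ^ 2 < 1) :
    paramToSSCM θ = ![(θ 0 + √(1 - θ 1 ^ 2)) / (θ 0 + (θ 0)⁻¹ + 2 * √(1 - θ 1 ^ 2)),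
      θ 1 / (θ 0 + (θ 0)⁻¹ + 2 * √(1 - θ 1 ^ 2))] := by
  have hN : θ 0 + (θ 0)⁻¹ + 2 * √(1 - θ 1 ^ 2) ≠ 0 := by positivity
  rw [paramToSSCM_eq_meanDirSq ha hρ, meanDirSq, trace_shape₀, det_shape₀ ha.ne']
  ext i
  fin_cases i
  · simp only [shape₀, Matrix.of_apply, Matrix.cons_val', Matrix.cons_val_zero, Matrix.cons_val_one,
      Matrix.cons_val_fin_one, Fin.zero_eta]
    rw [div_eq_div_iff two_ne_zero hN, one_add_div hN, div_mul_cancel₀ _ hN]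
    ring
  · simp [shape₀, mul_div_assoc]

theorem eventually_pos_and_sq_lt_one {a ρ : ℝ} (ha : 0 < a) (hρ : ρ ^ 2 < 1) :
    ∀ᶠ θ : Fin 2 → ℝ in 𝓝 ![a, ρ], 0 < θ 0 ∧ θ 1 ^ 2 < 1 :=
  have h₀ : Tendsto (fun θ : Fin 2 → ℝ => θ 0) (𝓝 ![a, ρ]) (𝓝 a) :=
    (continuous_apply 0).tendsto ![a, ρ]
  have h₁ : Tendsto (fun θ : Fin 2 → ℝ => θ 1 ^ 2) (𝓝 ![a, ρ]) (𝓝 (ρ ^ 2)) :=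
    ((continuous_apply 1).pow 2).tendsto ![a, ρ]
  (h₀.eventually_const_lt ha).and (h₁.eventually_lt_const hρ)

theorem hasFDerivAt_paramToSSCM {a ρ : ℝ} (ha : 0 < a) (hρ : ρ ^ 2 < 1) :
    HasFDerivAt paramToSSCM
      (LinearMap.toContinuousLinearMap (Matrix.toLin' (jacobian a ρ))) ![a, ρ] := by
  have hr : 0 < 1 - ρ ^ 2 := by linarith
  have hr' : √(1 - ρ ^ 2) ≠ 0 := (Real.sqrt_pos.2 hr).ne'
  have hN : a + a⁻¹ + 2 * √(1 - ρ ^ 2) ≠ 0 := by positivity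
  have h₀ := hasFDerivAt_apply (𝕜 := ℝ) (F' := fun _ : Fin 2 => ℝ) 0 ![a, ρ]
  have h₁ := hasFDerivAt_apply (𝕜 := ℝ) (F' := fun _ : Fin 2 => ℝ) 1 ![a, ρ]
  have hsqrt := ((h₁.pow 2).const_sub 1).sqrt hr.ne'
  have hden : HasFDerivAt (fun θ => θ 0 + (θ 0)⁻¹ + 2 * √(1 - θ 1 ^ 2)) _ ![a, ρ] :=
    (h₀.add ((hasDerivAt_inv ha.ne').comp_hasFDerivAt _ h₀)).add (hsqrt.const_mul 2)
  have hden_inv := HasDerivAt.comp_hasFDerivAt ![a, ρ] (hasDerivAt_inv hN) hden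
  have heq : paramToSSCM =ᶠ[𝓝 ![a, ρ]] fun θ =>
      ![(θ 0 + √(1 - θ 1 ^ 2)) * (θ 0 + (θ 0)⁻¹ + 2 * √(1 - θ 1 ^ 2))⁻¹,
        θ 1 * (θ 0 + (θ 0)⁻¹ + 2 * √(1 - θ 1 ^ 2))⁻¹] := by
    filter_upwards [eventually_pos_and_sq_lt_one ha hρ] with θ hθ
    rw [paramToSSCM_eq hθ.1 hθ.2, div_eq_mul_inv, div_eq_mul_inv]
  refine (hasFDerivAt_pi'.2 fun i => ?_).congr_of_eventuallyEq heq
  fin_cases i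
  · refine ((h₀.add hsqrt).mul hden_inv).congr_fderiv (ContinuousLinearMap.ext fun v => ?_)
    simp [jacobian, dotProduct, Fin.sum_univ_two]
    field_simp
    ring
  · refine (h₁.mul hden_inv).congr_fderiv (ContinuousLinearMap.ext fun v => ?_)
    simp [jacobian, dotProduct, Fin.sum_univ_two]
    field_simp
    linear_combination (2 * a ^ 2 * v 1) * Real.sq_sqrt hr.le

/-- The first two columns of `G`. -/
def G₂ (a ρ : ℝ) : Matrix (Fin 2) (Fin 2) ℝ :=
  (G a ρ).submatrix id (Fin.castLE (by norm_num : 2 ≤ 4))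

theorem G₂_mul_jacobian_one_zero : G₂ 1 0 * jacobian 1 0 = 1 := by
  ext i j
  fin_cases i <;> fin_cases j <;>
    norm_num [G₂, G, jacobian, Matrix.mul_apply, Fin.sum_univ_two, Fin.castLE]

theorem G₂_mul_jacobian {a ρ : ℝ} (ha : 0 < a) (hρ : ρ ^ 2 < 1) :
    G₂ a ρ * jacobian a ρ = 1 := by
  by_cases h : a = 1 ∧ ρ = 0
  · rw [h.1, h.2]
    exact G₂_mul_jacobian_one_zero
  have hΔ : 0 < 4 * a ^ 2 * ρ ^ 2 + (a ^ 2 - 1) ^ 2 := by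
    by_cases hρ0 : ρ = 0
    · have : a ^ 2 - 1 ≠ 0 := fun h' => h ⟨by nlinarith, hρ0⟩
      positivity
    · positivity
  have hr : 0 < √(1 - ρ ^ 2) := Real.sqrt_pos.2 (by linarith)
  have hr2 : √(1 - ρ ^ 2) ^ 2 = 1 - ρ ^ 2 := Real.sq_sqrt (by linarith)
  simp only [G₂, G, h, if_false, jacobian]
  generalize √(1 - ρ ^ 2) = r at *
  have hρr : ρ ^ 2 = 1 - r ^ 2 := by linarith
  have hN : a + a⁻¹ + 2 * r = (a ^ 2 + 1 + 2 * a * r) / a := by field_simp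
  have hN' : a ^ 2 + 1 + 2 * a * r ≠ 0 := by positivity
  rw [hN]
  generalize hΔ' : 4 * a ^ 2 * ρ ^ 2 + (a ^ 2 - 1) ^ 2 = Δ at *
  generalize hM : a ^ 2 + 1 + 2 * a * r = M at *
  ext i j
  fin_cases i <;> fin_cases j <;>
    simp [Matrix.mul_apply, Fin.sum_univ_two, Fin.castLE] <;> field_simp <;>
    simp only [hρr, ← hM, ← hΔ'] <;> ring

/-! ### The asymptotic covariance matrix -/

/-- The projection of `ℝ⁴` onto its first two coordinates, which extracts the elements `(1, 1)` and
`(1, 2)` from the vectorization of a `2 × 2` matrix. -/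
def firstTwo : Matrix (Fin 2) (Fin 4) ℝ := !![1, 0, 0, 0; 0, 1, 0, 0]

theorem G_eq_G₂_mul_firstTwo (a ρ : ℝ) : G a ρ = G₂ a ρ * firstTwo := by
  by_cases h : a = 1 ∧ ρ = 0 <;> ext i j <;> fin_cases i <;> fin_cases j <;>
    simp [G₂, G, firstTwo, h, Matrix.mul_apply, Fin.sum_univ_two, Fin.castLE]

theorem kronSq_apply (U : Matrix (Fin 2) (Fin 2) ℝ) (i j k l : Fin 2) :
    kronSq U (finProdFinEquiv (i, j)) (finProdFinEquiv (k, l)) = U i k * U j l := by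
  simp [kronSq]

/-- `W₀` is the identity plus the commutation matrix minus `vec(I) vec(I)ᵀ`, each of which is
invariant under conjugation by `U ⊗ U`. -/
theorem W₀_apply (i j k l : Fin 2) :
    W₀ (finProdFinEquiv (i, j)) (finProdFinEquiv (k, l)) =
      (1 : Matrix (Fin 2) (Fin 2) ℝ) i k * (1 : Matrix (Fin 2) (Fin 2) ℝ) j l +
        (1 : Matrix (Fin 2) (Fin 2) ℝ) i l * (1 : Matrix (Fin 2) (Fin 2) ℝ) j k -
        (1 : Matrix (Fin 2) (Fin 2) ℝ) i j * (1 : Matrix (Fin 2) (Fin 2) ℝ) k l := by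
  fin_cases i <;> fin_cases j <;> fin_cases k <;> fin_cases l <;>
    norm_num [W₀, finProdFinEquiv, Matrix.one_apply]

theorem kronSq_conj_W₀ {U : Matrix (Fin 2) (Fin 2) ℝ}
    (hU : U ∈ Matrix.orthogonalGroup (Fin 2) ℝ) :
    kronSq U * W₀ * (kronSq U).transpose = W₀ := by
  ext p q
  obtain ⟨⟨i, j⟩, rfl⟩ := (finProdFinEquiv (m := 2) (n := 2)).surjective p
  obtain ⟨⟨k, l⟩, rfl⟩ := (finProdFinEquiv (m := 2) (n := 2)).surjective q
  have hsum (f : Fin 4 → ℝ) :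
      ∑ r, f r = ∑ m : Fin 2, ∑ n : Fin 2, f (finProdFinEquiv (m, n)) := by
    rw [← (finProdFinEquiv (m := 2) (n := 2)).sum_comp f, Fintype.sum_prod_type]
  have hone (i j : Fin 2) : (1 : Matrix (Fin 2) (Fin 2) ℝ) i j = U i 0 * U j 0 + U i 1 * U j 1 := by
    rw [← (Matrix.mem_orthogonalGroup_iff (Fin 2) ℝ).1 hU, Matrix.mul_apply, Fin.sum_univ_two]
    rfl
  rw [W₀_apply i j k l]
  simp only [hone]
  simp only [Matrix.mul_apply, Matrix.transpose_apply, hsum, kronSq_apply, W₀_apply,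
    Fin.sum_univ_two, Matrix.one_apply_eq, ne_eq, zero_ne_one, one_ne_zero, not_false_eq_true,
    Matrix.one_apply_ne]
  ring

theorem firstTwo_mul_W₀_mul_transpose : firstTwo * W₀ * firstTwo.transpose = 1 := by
  ext i j
  fin_cases i <;> fin_cases j <;> simp [firstTwo, W₀, Matrix.mul_apply, Fin.sum_univ_four]

theorem wCoeff_eq {l₁ l₂ : ℝ} (h₁ : 0 < l₁) (h₂ : 0 < l₂) :
    wCoeff l₁ l₂ = √(l₁ * l₂) / (2 * (l₁ + l₂ + 2 * √(l₁ * l₂))) := by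
  rw [wCoeff]
  split_ifs with h
  · subst h
    rw [Real.sqrt_mul_self h₁.le]
    field_simp
    norm_num
  · have hr : √(l₁ * l₂) ^ 2 = l₁ * l₂ := Real.sq_sqrt (by positivity)
    have : l₁ - l₂ ≠ 0 := sub_ne_zero.2 h
    rw [div_eq_div_iff (by positivity) (by positivity)]
    linear_combination (2 * (l₁ + l₂)) * hr

section Covariance

variable {V U : Matrix (Fin 2) (Fin 2) ℝ} {l₁ l₂ : ℝ}

theorem wCoeff_eq_meanDirSq (hV : V.PosDef) (hU : U ∈ Matrix.orthogonalGroup (Fin 2) ℝ)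
    (hVU : V = U * Matrix.diagonal ![l₁, l₂] * U.transpose) :
    wCoeff l₁ l₂ = (1 - ‖meanDirSq V‖ ^ 2) / 8 := by
  have hUt : U.transpose * U = 1 := (Matrix.mem_orthogonalGroup_iff' (Fin 2) ℝ).1 hU
  have htr : l₁ + l₂ = V.trace := by
    rw [hVU, Matrix.trace_mul_cycle, hUt, Matrix.one_mul, Matrix.trace_diagonal]
    simp
  have hdet : l₁ * l₂ = V.det := by
    rw [hVU, Matrix.det_mul, mul_comm _ (Matrix.det U.transpose), ← Matrix.det_mul,
      ← Matrix.mul_assoc, hUt, Matrix.one_mul, Matrix.det_diagonal]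
    simp
  obtain ⟨h₁, h₂⟩ := pos_and_pos_of_mul_pos_of_add_pos (hdet ▸ hV.det_pos) (htr ▸ hV.trace_pos)
  have := trace_add_two_mul_sqrt_det_pos hV
  rw [wCoeff_eq h₁ h₂, one_sub_norm_meanDirSq_sq hV, hdet, htr]
  field_simp
  ring

theorem WV₀_eq (hV : V.PosDef) (hU : U ∈ Matrix.orthogonalGroup (Fin 2) ℝ)
    (hVU : V = U * Matrix.diagonal ![l₁, l₂] * U.transpose) (a ρ : ℝ) :
    WV₀ a ρ U l₁ l₂ = ((1 - ‖meanDirSq V‖ ^ 2) / 8) • (G₂ a ρ * (G₂ a ρ).transpose) := by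
  rw [WV₀, WS, kronSq_conj_W₀ hU, wCoeff_eq_meanDirSq hV hU hVU, G_eq_G₂_mul_firstTwo,
    Matrix.transpose_mul, Matrix.mul_smul, Matrix.smul_mul]
  congr 1
  calc _ = G₂ a ρ * (firstTwo * W₀ * firstTwo.transpose) * (G₂ a ρ).transpose := by
        simp only [Matrix.mul_assoc]
    _ = G₂ a ρ * (G₂ a ρ).transpose := by rw [firstTwo_mul_W₀_mul_transpose, Matrix.mul_one]

theorem WV₀_posSemidef (hV : V.PosDef) (hU : U ∈ Matrix.orthogonalGroup (Fin 2) ℝ)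
    (hVU : V = U * Matrix.diagonal ![l₁, l₂] * U.transpose) (a ρ : ℝ) :
    (WV₀ a ρ U l₁ l₂).PosSemidef := by
  have hq : ‖meanDirSq V‖ ^ 2 ≤ 1 :=
    pow_le_one₀ (norm_nonneg _) (norm_meanDirSq_lt_one hV).le
  rw [WV₀_eq hV hU hVU, ← Matrix.conjTranspose_eq_transpose_of_trivial]
  exact (Matrix.posSemidef_self_mul_conjTranspose _).smul (by linarith)

end Covariance

/-! ### The derivative of `dirSqToParam` -/

/-- The identification of `ℝ²` with `ℂ`. The argument works with complex coordinates, in which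
doubling the angle of a vector is a multiplicative operation. -/
def toComplex : Vec 2 ≃ₗᵢ[ℝ] ℂ := Complex.orthonormalBasisOneI.repr.symm

theorem toComplex_re (x : Vec 2) : (toComplex x).re = x 0 := by
  simp [toComplex]

theorem toComplex_im (x : Vec 2) : (toComplex x).im = x 1 := by
  simp [toComplex]

/-- The doubled-angle vector of a symmetric matrix with trace `1` and elements `(s₁₁, s₁₂)`. -/
def sscmToDirSq (s : Fin 2 → ℝ) : ℂ := (2 : ℝ) • toComplex (WithLp.toLp 2 s) - 1

theorem sscmToDirSq_paramToSSCM {θ : Fin 2 → ℝ} (ha : 0 < θ 0) (hρ : θ 1 ^ 2 < 1) :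
    sscmToDirSq (paramToSSCM θ) = meanDirSq (shape₀ (θ 0) (θ 1)) := by
  rw [paramToSSCM_eq_meanDirSq ha hρ]
  apply Complex.ext <;> simp [sscmToDirSq, toComplex_re, toComplex_im] <;> ring

theorem dirSqToParam_sscmToDirSq_paramToSSCM {θ : Fin 2 → ℝ} (ha : 0 < θ 0) (hρ : θ 1 ^ 2 < 1) :
    dirSqToParam (sscmToDirSq (paramToSSCM θ)) = WithLp.toLp 2 θ := by
  rw [sscmToDirSq_paramToSSCM ha hρ, dirSqToParam_meanDirSq (posDef_shape₀ ha hρ),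
    ratio_shape₀ ha.le, corr_shape₀ ha.ne']
  ext i
  fin_cases i <;> rfl

theorem hasFDerivAt_sscmToDirSq (s : Fin 2 → ℝ) :
    HasFDerivAt sscmToDirSq
      ((2 : ℝ) • (toComplex.toContinuousLinearEquiv : Vec 2 →L[ℝ] ℂ) ∘L
        ((EuclideanSpace.equiv (Fin 2) ℝ).symm : (Fin 2 → ℝ) →L[ℝ] Vec 2)) s :=
  (((toComplex.toContinuousLinearEquiv : Vec 2 →L[ℝ] ℂ) ∘L
    ((EuclideanSpace.equiv (Fin 2) ℝ).symm : (Fin 2 → ℝ) →L[ℝ] Vec 2)).hasFDerivAt.const_smul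
      (2 : ℝ)).sub_const 1

theorem differentiableAt_dirSqToParam {q : ℂ} (hq : ‖q‖ < 1) :
    DifferentiableAt ℝ dirSqToParam q := by
  have h₁ := one_add_ne_zero_of_norm_lt_one hq
  have h₂ := one_sub_ne_zero_of_norm_lt_one hq
  have n₁ : ‖1 + q‖ ≠ 0 := norm_ne_zero_iff.2 h₁
  have n₂ : ‖1 - q‖ ≠ 0 := norm_ne_zero_iff.2 h₂
  have d₁ : DifferentiableAt ℝ (fun q : ℂ => ‖1 + q‖) q :=
    DifferentiableAt.norm ℝ (by fun_prop) h₁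
  have d₂ : DifferentiableAt ℝ (fun q : ℂ => ‖1 - q‖) q :=
    DifferentiableAt.norm ℝ (by fun_prop) h₂
  have d₃ : DifferentiableAt ℝ (fun q : ℂ => q.im) q := Complex.imCLM.differentiableAt
  have e₁ : DifferentiableAt ℝ (fun q : ℂ => ‖1 + q‖ / ‖1 - q‖) q := by
    fun_prop (disch := assumption)
  have e₂ : DifferentiableAt ℝ (fun q : ℂ => 2 * q.im / (‖1 + q‖ * ‖1 - q‖)) q := by
    have n₁₂ := mul_ne_zero n₁ n₂
    fun_prop (disch := assumption)
  exact (differentiableAt_euclidean (𝕜 := ℝ)).2 (Fin.forall_fin_two.2 ⟨e₁, e₂⟩)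

/-- The derivative of `dirSqToParam` at the doubled-angle vector `meanDirSq V`. -/
def dirSqToParamDeriv (V : Matrix (Fin 2) (Fin 2) ℝ) : ℂ →L[ℝ] Vec 2 :=
  (2⁻¹ : ℝ) • Matrix.toEuclideanCLM (𝕜 := ℝ) (G₂ (ratio V) (corr V)) ∘L
    (toComplex.symm.toContinuousLinearEquiv : ℂ →L[ℝ] Vec 2)

theorem hasFDerivAt_dirSqToParam {V : Matrix (Fin 2) (Fin 2) ℝ} (hV : V.PosDef) :
    HasFDerivAt dirSqToParam (dirSqToParamDeriv V) (meanDirSq V) := by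
  have ha := ratio_pos hV
  have hρ := corr_sq_lt_one hV
  have hL := (differentiableAt_dirSqToParam (norm_meanDirSq_lt_one hV)).hasFDerivAt
  have hq : sscmToDirSq (paramToSSCM ![ratio V, corr V]) = meanDirSq V := by
    rw [sscmToDirSq_paramToSSCM ha hρ]
    exact meanDirSq_shape₀_ratio_corr hV
  rw [← hq] at hL ⊢
  set L := fderiv ℝ dirSqToParam (sscmToDirSq (paramToSSCM ![ratio V, corr V]))
  have hcomp := hL.comp ![ratio V, corr V]
    ((hasFDerivAt_sscmToDirSq _).comp _ (hasFDerivAt_paramToSSCM ha hρ))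
  have hinv : dirSqToParam ∘ sscmToDirSq ∘ paramToSSCM =ᶠ[𝓝 ![ratio V, corr V]]
      (EuclideanSpace.equiv (Fin 2) ℝ).symm := by
    filter_upwards [eventually_pos_and_sq_lt_one ha hρ] with θ hθ
    exact dirSqToParam_sscmToDirSq_paramToSSCM hθ.1 hθ.2
  have huniq := (hcomp.congr_of_eventuallyEq hinv.symm).unique
    (ContinuousLinearEquiv.hasFDerivAt _)
  have hJG : jacobian (ratio V) (corr V) * G₂ (ratio V) (corr V) = 1 :=
    mul_eq_one_comm.1 (G₂_mul_jacobian ha hρ)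
  have hLG : L = dirSqToParamDeriv V := by
    ext1 z
    have h := DFunLike.congr_fun huniq ((2⁻¹ : ℝ) • (G₂ (ratio V) (corr V)).mulVec
      (toComplex.symm z).ofLp)
    simp only [ContinuousLinearMap.comp_apply, LinearMap.coe_toContinuousLinearMap',
      Matrix.toLin'_apply, Matrix.mulVec_smul, Matrix.mulVec_mulVec, hJG, Matrix.one_mulVec] at h
    have hz : L z = WithLp.toLp 2 ((2⁻¹ : ℝ) •
        (G₂ (ratio V) (corr V)).mulVec (toComplex.symm z).ofLp) := by
      simpa using h
    exact hz
  rwa [← hLG]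

theorem toEuclideanCLM_WV₀ {V U : Matrix (Fin 2) (Fin 2) ℝ} {l₁ l₂ : ℝ} (hV : V.PosDef)
    (hU : U ∈ Matrix.orthogonalGroup (Fin 2) ℝ)
    (hVU : V = U * Matrix.diagonal ![l₁, l₂] * U.transpose) :
    Matrix.toEuclideanCLM (𝕜 := ℝ) (WV₀ (ratio V) (corr V) U l₁ l₂) =
      ((1 - ‖meanDirSq V‖ ^ 2) / 2) •
        dirSqToParamDeriv V ∘L ContinuousLinearMap.adjoint (dirSqToParamDeriv V) := by
  rw [WV₀_eq hV hU hVU, ← Matrix.conjTranspose_eq_transpose_of_trivial,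
    ← Matrix.star_eq_conjTranspose, map_smul, map_mul, map_star,
    ContinuousLinearMap.star_eq_adjoint]
  have hadj : ContinuousLinearMap.adjoint (dirSqToParamDeriv V) = (2⁻¹ : ℝ) •
      (toComplex.toContinuousLinearEquiv : Vec 2 →L[ℝ] ℂ) ∘L ContinuousLinearMap.adjoint
        (Matrix.toEuclideanCLM (𝕜 := ℝ) (G₂ (ratio V) (corr V))) := by
    rw [dirSqToParamDeriv, map_smulₛₗ, ContinuousLinearMap.adjoint_comp,
      LinearIsometryEquiv.adjoint_eq_symm]
    rfl
  rw [hadj]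
  ext1 x
  simp [dirSqToParamDeriv, smul_smul]
  ring_nf

/-! ### Doubled-angle directions -/

/-- The square `w² / ‖w‖²` of the direction of `w`, and `0` for `w = 0`. It encodes the matrix
`s(w) s(w)ᵀ`, which depends on the direction only up to sign. -/
def dirSq (w : ℂ) : ℂ := w / conj w

theorem dirSq_zero : dirSq 0 = 0 := by simp [dirSq]

theorem dirSq_of_norm_eq_one {w : ℂ} (hw : ‖w‖ = 1) : dirSq w = w ^ 2 := by
  rw [dirSq, ← Complex.inv_eq_conj hw, div_inv_eq_mul, sq]

theorem dirSq_mul (z w : ℂ) : dirSq (z * w) = dirSq z * dirSq w := by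
  rw [dirSq, map_mul, mul_div_mul_comm, dirSq, dirSq]

theorem norm_dirSq {w : ℂ} (hw : w ≠ 0) : ‖dirSq w‖ = 1 := by
  rw [dirSq, norm_div, Complex.norm_conj, div_self (norm_ne_zero_iff.2 hw)]

theorem norm_dirSq_le (w : ℂ) : ‖dirSq w‖ ≤ 1 := by
  rw [dirSq, norm_div, Complex.norm_conj]
  exact div_self_le_one _

theorem measurable_dirSq : Measurable dirSq :=
  measurable_id.div Complex.continuous_conj.measurable

theorem abs_im_le_min_mul_norm_one_sub (τ : ℂ) : |τ.im| ≤ min 1 ‖τ‖ * ‖1 - τ‖ := by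
  rw [min_mul_of_nonneg _ _ (norm_nonneg _)]
  refine le_min ?_ ?_
  · simpa using Complex.abs_im_le_norm (1 - τ)
  · have him : (conj τ * (1 - τ)).im = -τ.im := by
      simp [Complex.mul_im]
      ring
    rw [← abs_neg, ← him, ← Complex.norm_conj τ, ← norm_mul]
    exact Complex.abs_im_le_norm _

theorem min_one_mul_self_le_rpow {x : ℝ} (hx : 0 ≤ x) : min 1 x * x ≤ x ^ (3 / 2 : ℝ) := by
  rcases le_total x 1 with h | h
  · rw [min_eq_right h, ← sq, ← Real.rpow_two]
    exact Real.rpow_le_rpow_of_exponent_ge' hx h (by norm_num) (by norm_num)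
  · rw [min_eq_left h, one_mul]
    exact Real.self_le_rpow_of_one_le h (by norm_num)

/-- The remainder is also of order `‖τ‖ ^ 2`, but `‖w‖ ^ (-2)` is not locally integrable in the
plane, whereas `‖w‖ ^ (-3 / 2)` is. -/
theorem norm_dirSq_one_sub_sub_le (τ : ℂ) :
    ‖dirSq (1 - τ) - 1 + (τ - conj τ)‖ ≤ 2 * ‖τ‖ ^ (3 / 2 : ℝ) := by
  rcases eq_or_ne (1 - τ) 0 with hτ | hτ
  · rw [sub_eq_zero] at hτ
    simp [← hτ, dirSq_zero]
  have hconj : conj (1 - τ) ≠ 0 := (map_ne_zero _).2 hτ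
  have hrem : dirSq (1 - τ) - 1 + (τ - conj τ) = -((τ - conj τ) * conj τ) / conj (1 - τ) := by
    rw [dirSq, eq_div_iff hconj, add_mul, sub_mul, div_mul_cancel₀ _ hconj, map_sub, map_one]
    ring
  have hsub : ‖τ - conj τ‖ = 2 * |τ.im| := by
    rw [Complex.sub_conj]
    simp
  calc ‖dirSq (1 - τ) - 1 + (τ - conj τ)‖ = 2 * |τ.im| * ‖τ‖ / ‖1 - τ‖ := by
        rw [hrem, norm_div, norm_neg, norm_mul, hsub, Complex.norm_conj, Complex.norm_conj]
    _ ≤ 2 * (min 1 ‖τ‖ * ‖1 - τ‖) * ‖τ‖ / ‖1 - τ‖ := by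
        gcongr
        exact abs_im_le_min_mul_norm_one_sub τ
    _ = 2 * (min 1 ‖τ‖ * ‖τ‖) := by
        have := norm_ne_zero_iff.2 hτ
        field_simp
    _ ≤ 2 * ‖τ‖ ^ (3 / 2 : ℝ) := by
        gcongr
        exact min_one_mul_self_le_rpow (norm_nonneg τ)

theorem norm_dirSq_sub_sub_le {y : ℂ} (hy : y ≠ 0) (t : ℂ) :
    ‖dirSq (y - t) - dirSq y + (t * (conj y)⁻¹ - conj t * (dirSq y * (conj y)⁻¹))‖ ≤
      2 * (‖t‖ ^ (3 / 2 : ℝ) * ‖y‖ ^ (-(3 / 2) : ℝ)) := by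
  have hcy : conj y ≠ 0 := (map_ne_zero _).2 hy
  have hdir : dirSq (y - t) = dirSq y * dirSq (1 - t / y) := by
    rw [← dirSq_mul, mul_sub, mul_one, mul_div_cancel₀ _ hy]
  have hlin : t * (conj y)⁻¹ - conj t * (dirSq y * (conj y)⁻¹) =
      dirSq y * (t / y - conj (t / y)) := by
    rw [dirSq, map_div₀]
    field_simp
  have hpow : ‖t‖ ^ (3 / 2 : ℝ) * ‖y‖ ^ (-(3 / 2) : ℝ) = ‖t / y‖ ^ (3 / 2 : ℝ) := by
    rw [norm_div, Real.div_rpow (norm_nonneg _) (norm_nonneg _), Real.rpow_neg (norm_nonneg _),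
      div_eq_mul_inv (‖t‖ ^ _)]
  rw [hdir, hlin, hpow, ← mul_sub_one, ← mul_add, norm_mul, norm_dirSq hy, one_mul]
  exact norm_dirSq_one_sub_sub_le _

theorem one_sub_norm_dirSq_sub_le {y : ℂ} (hy : y ≠ 0) (t : ℂ) :
    1 - ‖dirSq (y - t)‖ ≤ ‖t‖ ^ (3 / 2 : ℝ) * ‖y‖ ^ (-(3 / 2) : ℝ) := by
  rcases eq_or_ne (y - t) 0 with h | h
  · rw [sub_eq_zero] at h
    subst h
    rw [← Real.rpow_add (norm_pos_iff.2 hy)]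
    simp [dirSq_zero]
  · rw [norm_dirSq h, sub_self]
    positivity

/-! ### A quadratic lower bound for the distance -/

/-- The direction `w / ‖w‖`, that is, the spatial sign in complex coordinates. -/
def dir (w : ℂ) : ℂ := w / ‖w‖

/-- The weight in the quadratic lower bound `distWeight_mul_le_norm_sub` for the distance. -/
def distWeight (w : ℂ) : ℝ := (4 * (1 + ‖w‖))⁻¹

theorem norm_dir_le (w : ℂ) : ‖dir w‖ ≤ 1 := by
  rw [dir, norm_div, Complex.norm_real, norm_norm]
  exact div_self_le_one _

theorem norm_dir {w : ℂ} (hw : w ≠ 0) : ‖dir w‖ = 1 := by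
  rw [dir, norm_div, Complex.norm_real, norm_norm, div_self (norm_ne_zero_iff.2 hw)]

theorem mul_conj_dir (w : ℂ) : w * conj (dir w) = ‖w‖ := by
  rw [dir, map_div₀, Complex.conj_ofReal, mul_div_assoc', Complex.mul_conj', sq, mul_self_div_self]

theorem dir_sq (w : ℂ) : dir w ^ 2 = dirSq w := by
  rw [dir, dirSq, div_pow, ← Complex.mul_conj', sq, mul_div_mul_comm]
  rcases eq_or_ne w 0 with rfl | hw
  · simp
  · rw [div_self hw, one_mul]

theorem measurable_dir : Measurable dir :=
  measurable_id.div (Complex.measurable_ofReal.comp measurable_norm)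

theorem distWeight_pos (w : ℂ) : 0 < distWeight w := by
  unfold distWeight
  positivity

theorem distWeight_le_one (w : ℂ) : distWeight w ≤ 1 :=
  inv_le_one_of_one_le₀ (by linarith [norm_nonneg w])

theorem measurable_distWeight : Measurable distWeight :=
  ((measurable_norm.const_add 1).const_mul 4).inv

theorem neg_re_add_im_sq_div_le_norm_ofReal_sub {r : ℝ} (hr : 0 ≤ r) {z : ℂ} (hz : ‖z‖ ≤ 1) :
    -z.re + z.im ^ 2 / (2 * (1 + r)) ≤ ‖(r : ℂ) - z‖ - r := by
  have hsq : ‖(r : ℂ) - z‖ ^ 2 = (r - z.re) ^ 2 + z.im ^ 2 := by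
    rw [← Complex.normSq_eq_norm_sq, Complex.normSq_apply]
    simp
    ring
  have hle : ‖(r : ℂ) - z‖ ≤ r + 1 :=
    (norm_sub_le _ _).trans (by rw [Complex.norm_of_nonneg hr]; linarith)
  have hge : r - z.re ≤ ‖(r : ℂ) - z‖ := by
    simpa using Complex.re_le_norm ((r : ℂ) - z)
  have hre : -1 ≤ z.re := neg_le_of_abs_le ((Complex.abs_re_le_norm z).trans hz)
  have hdiv : z.im ^ 2 / (2 * (1 + r)) ≤ ‖(r : ℂ) - z‖ - (r - z.re) := by
    rw [div_le_iff₀ (by positivity)]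
    calc z.im ^ 2 = (‖(r : ℂ) - z‖ - (r - z.re)) * (‖(r : ℂ) - z‖ + (r - z.re)) := by
          linear_combination -hsq
      _ ≤ (‖(r : ℂ) - z‖ - (r - z.re)) * (2 * (1 + r)) :=
          mul_le_mul_of_nonneg_left (by linarith [hre]) (by linarith)
  linarith

theorem distWeight_mul_le_norm_sub {y t : ℂ} (hy : y ≠ 0) (ht : ‖t‖ ≤ 1) :
    -inner ℝ (dir y) t + distWeight y * (‖t‖ ^ 2 - inner ℝ (dirSq y) (t ^ 2)) ≤
      ‖y - t‖ - ‖y‖ := by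
  set z := t * conj (dir y) with hz
  have hnorm (w : ℂ) : ‖w * conj (dir y)‖ = ‖w‖ := by
    rw [norm_mul, Complex.norm_conj, norm_dir hy, mul_one]
  have hdist : ‖y - t‖ = ‖(‖y‖ : ℂ) - z‖ := by
    rw [← hnorm (y - t), sub_mul, mul_conj_dir]
  have hsq : t ^ 2 * conj (dirSq y) = z ^ 2 := by
    rw [← dir_sq, map_pow, hz, mul_pow]
  have him : ‖t‖ ^ 2 - (z ^ 2).re = 2 * z.im ^ 2 := by
    rw [← hnorm t, ← Complex.normSq_eq_norm_sq, ← hz, Complex.normSq_apply, pow_two z,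
      Complex.mul_re z z]
    ring
  have hmain := neg_re_add_im_sq_div_le_norm_ofReal_sub (norm_nonneg y) ((hnorm t).trans_le ht)
  rw [Complex.inner, Complex.inner, hdist, hsq, him, distWeight]
  convert hmain using 2
  field_simp
  ring

/-! ### Averages over samples -/

/-- The average of `f` over `y 0, …, y (n - 1)`. -/
def avg {α E : Type*} [AddCommGroup E] [Module ℝ E] (n : ℕ) (y : ℕ → α) (f : α → E) : E :=
  (n : ℝ)⁻¹ • ∑ i ∈ Finset.range n, f (y i)

section Avg

variable {α E F : Type*}

theorem avg_add [AddCommGroup E] [Module ℝ E] (n : ℕ) (y : ℕ → α) (f g : α → E) :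
    avg n y (fun w => f w + g w) = avg n y f + avg n y g := by
  simp only [avg, Finset.sum_add_distrib, smul_add]

theorem avg_sub [AddCommGroup E] [Module ℝ E] (n : ℕ) (y : ℕ → α) (f g : α → E) :
    avg n y (fun w => f w - g w) = avg n y f - avg n y g := by
  simp only [avg, Finset.sum_sub_distrib, smul_sub]

theorem avg_const [AddCommGroup E] [Module ℝ E] {n : ℕ} (hn : n ≠ 0) (y : ℕ → α) (c : E) :
    avg n y (fun _ => c) = c := by
  rw [avg, Finset.sum_const, Finset.card_range, ← Nat.cast_smul_eq_nsmul ℝ, smul_smul,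
    inv_mul_cancel₀ (Nat.cast_ne_zero.2 hn), one_smul]

theorem map_avg [AddCommGroup E] [Module ℝ E] [AddCommGroup F] [Module ℝ F] (L : E →ₗ[ℝ] F)
    (n : ℕ) (y : ℕ → α) (f : α → E) : L (avg n y f) = avg n y fun w => L (f w) := by
  rw [avg, map_smul, map_sum, avg]

theorem avg_const_mul {R : Type*} [Ring R] [Algebra ℝ R] (n : ℕ) (y : ℕ → α) (c : R)
    (f : α → R) : avg n y (fun w => c * f w) = c * avg n y f :=
  (map_avg (LinearMap.mulLeft ℝ c) n y f).symm

theorem avg_mono (n : ℕ) {y : ℕ → α} {f g : α → ℝ} (h : ∀ i, f (y i) ≤ g (y i)) :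
    avg n y f ≤ avg n y g :=
  mul_le_mul_of_nonneg_left (Finset.sum_le_sum fun i _ => h i) (by positivity)

theorem norm_avg_le [NormedAddCommGroup E] [NormedSpace ℝ E] (n : ℕ) {y : ℕ → α} {f : α → E}
    {g : α → ℝ} (h : ∀ i, ‖f (y i)‖ ≤ g (y i)) : ‖avg n y f‖ ≤ avg n y g := by
  rw [avg, norm_smul_of_nonneg (by positivity)]
  exact mul_le_mul_of_nonneg_left (norm_sum_le_of_le _ fun i _ => h i) (by positivity)

end Avg

theorem convexOn_avg_norm_sub {E : Type*} [NormedAddCommGroup E] [NormedSpace ℝ E] (n : ℕ)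
    (y : ℕ → E) : ConvexOn ℝ Set.univ fun u => avg n y fun w => ‖w - u‖ - ‖w‖ := by
  refine ⟨convex_univ, fun u _ v _ a b ha hb hab => ?_⟩
  rw [smul_eq_mul, smul_eq_mul, ← avg_const_mul, ← avg_const_mul, ← avg_add]
  refine avg_mono n fun i => ?_
  have h := (convexOn_univ_dist (y i)).2 (Set.mem_univ u) (Set.mem_univ v) ha hb hab
  simp only [dist_comm _ (y i), dist_eq_norm, smul_eq_mul] at h
  linear_combination h + ‖y i‖ * hab

theorem mul_norm_le_of_convexOn {E : Type*} [NormedAddCommGroup E] [NormedSpace ℝ E] {f : E → ℝ}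
    (hf : ConvexOn ℝ Set.univ f) (hf₀ : f 0 = 0) {b c : ℝ} (hb : 0 ≤ b) (hbc : b < c)
    (hlow : ∀ u, ‖u‖ ≤ 1 → c * ‖u‖ ^ 2 - b * ‖u‖ ≤ f u) {t : E} (ht : f t ≤ 0) :
    c * ‖t‖ ≤ b := by
  rcases eq_or_ne t 0 with rfl | ht₀
  · rwa [norm_zero, mul_zero]
  have hpos : 0 < ‖t‖ := norm_pos_iff.2 ht₀
  by_contra! hlt
  rcases le_or_gt ‖t‖ 1 with h₁ | h₁
  · have := (hlow t h₁).trans ht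
    nlinarith
  · have hconv := hf.2 (Set.mem_univ 0) (Set.mem_univ t)
      (sub_nonneg.2 (inv_le_one_of_one_le₀ h₁.le)) (inv_nonneg.2 hpos.le) (sub_add_cancel 1 _)
    rw [hf₀, smul_zero, smul_zero, zero_add, zero_add, smul_eq_mul] at hconv
    have hunit : ‖‖t‖⁻¹ • t‖ = 1 := norm_smul_inv_norm (𝕜 := ℝ) ht₀
    have := hlow _ hunit.le
    rw [hunit] at this
    nlinarith [mul_nonpos_of_nonneg_of_nonpos (inv_nonneg.2 hpos.le) ht]

/-! ### Deterministic bounds for the spatial median and the estimator -/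

theorem inner_avg_left {α E : Type*} [NormedAddCommGroup E] [InnerProductSpace ℝ E] (n : ℕ)
    (y : ℕ → α) (f : α → E) (u : E) :
    inner ℝ (avg n y f) u = avg n y fun w => inner ℝ (f w) u :=
  map_avg ((innerₗ E).flip u) n y f

/-- The curvature of the quadratic lower bound for the objective function of the spatial median. -/
def curvature (n : ℕ) (y : ℕ → ℂ) : ℝ :=
  avg n y distWeight - ‖avg n y fun w => distWeight w • dirSq w‖

theorem curvature_mul_norm_sq_sub_le {n : ℕ} {y : ℕ → ℂ} (hy : ∀ i, y i ≠ 0) {u : ℂ}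
    (hu : ‖u‖ ≤ 1) :
    curvature n y * ‖u‖ ^ 2 - ‖avg n y dir‖ * ‖u‖ ≤ avg n y fun w => ‖w - u‖ - ‖w‖ := by
  have hlow : avg n y (fun w => ‖u‖ ^ 2 * distWeight w -
      inner ℝ (distWeight w • dirSq w) (u ^ 2) - inner ℝ (dir w) u) ≤
        avg n y fun w => ‖w - u‖ - ‖w‖ := by
    refine avg_mono n fun i => le_of_eq_of_le ?_ (distWeight_mul_le_norm_sub (hy i) hu)
    rw [real_inner_smul_left]
    ring
  rw [avg_sub, avg_sub, avg_const_mul, ← inner_avg_left, ← inner_avg_left] at hlow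
  have h₁ := real_inner_le_norm (avg n y dir) u
  have h₂ := real_inner_le_norm (avg n y fun w => distWeight w • dirSq w) (u ^ 2)
  rw [norm_pow] at h₂
  rw [curvature]
  linarith

theorem mul_norm_spatialMedian_le {n : ℕ} {y : ℕ → ℂ} (hy : ∀ i, y i ≠ 0) {t : ℂ}
    (ht : ∀ u, ∑ i ∈ Finset.range n, ‖y i - t‖ ≤ ∑ i ∈ Finset.range n, ‖y i - u‖)
    {c : ℝ} (hc : c ≤ curvature n y) (hlt : ‖avg n y dir‖ < c) :
    c * ‖t‖ ≤ ‖avg n y dir‖ := by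
  refine mul_norm_le_of_convexOn (convexOn_avg_norm_sub n y) (by simp [avg]) (norm_nonneg _) hlt
    (fun u hu => le_trans ?_ (curvature_mul_norm_sq_sub_le hy hu)) ?_
  · gcongr
  · refine mul_nonpos_of_nonneg_of_nonpos (by positivity) ?_
    rw [Finset.sum_sub_distrib, sub_nonpos]
    simpa using ht 0

/-- The average doubled-angle direction around `t` of the observations different from `t`. -/
def dirSqEst (n : ℕ) (y : ℕ → ℂ) (t : ℂ) : ℂ :=
  (avg n y fun w => dirSq (w - t)) / (avg n y fun w => ‖dirSq (w - t)‖ : ℝ)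

theorem norm_div_ofReal_sub_self_le {q : ℂ} {e : ℝ} (hqe : ‖q‖ ≤ e) (he : e ≤ 1) :
    ‖q / e - q‖ ≤ 1 - e := by
  rcases eq_or_lt_of_le ((norm_nonneg q).trans hqe) with rfl | hpos
  · simp [norm_le_zero_iff.1 hqe]
  · have hq : q / e - q = q / e * (1 - e : ℝ) := by
      have : (e : ℂ) ≠ 0 := Complex.ofReal_ne_zero.2 hpos.ne'
      push_cast
      field_simp
    rw [hq, norm_mul, norm_div, Complex.norm_of_nonneg hpos.le,
      Complex.norm_of_nonneg (sub_nonneg.2 he)]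
    exact mul_le_of_le_one_left (sub_nonneg.2 he) ((div_le_one hpos).2 hqe)

section DirSqEst

variable {n : ℕ} {y : ℕ → ℂ}

theorem avg_norm_dirSq_le_one (n : ℕ) (y : ℕ → ℂ) (t : ℂ) :
    avg n y (fun w => ‖dirSq (w - t)‖) ≤ 1 := by
  rw [avg, smul_eq_mul]
  refine inv_mul_le_of_le_mul₀ n.cast_nonneg zero_le_one ?_
  simpa using Finset.sum_le_sum fun i (_ : i ∈ Finset.range n) => norm_dirSq_le (y i - t)

theorem one_sub_avg_norm_dirSq_le (hn : n ≠ 0) (hy : ∀ i, y i ≠ 0) (t : ℂ) :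
    1 - avg n y (fun w => ‖dirSq (w - t)‖) ≤
      ‖t‖ ^ (3 / 2 : ℝ) * avg n y fun w => ‖w‖ ^ (-(3 / 2) : ℝ) := by
  rw [← avg_const_mul]
  nth_rw 1 [← avg_const hn y (1 : ℝ)]
  rw [← avg_sub]
  exact avg_mono n fun i => one_sub_norm_dirSq_sub_le (hy i) t

theorem norm_avg_dirSq_sub_sub_le (hy : ∀ i, y i ≠ 0) (t : ℂ) :
    ‖avg n y (fun w => dirSq (w - t)) - avg n y dirSq‖ ≤
      ‖t‖ * (‖avg n y fun w => (conj w)⁻¹‖ + ‖avg n y fun w => dirSq w * (conj w)⁻¹‖) +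
        2 * ‖t‖ ^ (3 / 2 : ℝ) * avg n y fun w => ‖w‖ ^ (-(3 / 2) : ℝ) := by
  have hrem : ‖avg n y fun w => dirSq (w - t) - dirSq w +
      (t * (conj w)⁻¹ - conj t * (dirSq w * (conj w)⁻¹))‖ ≤
        avg n y fun w => 2 * (‖t‖ ^ (3 / 2 : ℝ) * ‖w‖ ^ (-(3 / 2) : ℝ)) :=
    norm_avg_le n fun i => norm_dirSq_sub_sub_le (hy i) t
  rw [avg_add, avg_sub, avg_sub, avg_const_mul, avg_const_mul, avg_const_mul, avg_const_mul,
    ← mul_assoc] at hrem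
  have hlin : ‖t * avg n y (fun w => (conj w)⁻¹) -
      conj t * avg n y fun w => dirSq w * (conj w)⁻¹‖ ≤
        ‖t‖ * (‖avg n y fun w => (conj w)⁻¹‖ + ‖avg n y fun w => dirSq w * (conj w)⁻¹‖) := by
    refine (norm_sub_le _ _).trans_eq ?_
    rw [norm_mul, norm_mul, Complex.norm_conj, mul_add]
  have htri := norm_le_norm_add_norm_sub' (avg n y (fun w => dirSq (w - t)) - avg n y dirSq)
    (conj t * avg n y (fun w => dirSq w * (conj w)⁻¹) - t * avg n y fun w => (conj w)⁻¹)
  rw [sub_sub_eq_add_sub, add_sub_assoc, norm_sub_rev (conj t * _)] at htri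
  linarith

theorem norm_dirSqEst_sub_avg_le (hn : n ≠ 0) (hy : ∀ i, y i ≠ 0) (t : ℂ) :
    ‖dirSqEst n y t - avg n y dirSq‖ ≤
      ‖t‖ * (‖avg n y fun w => (conj w)⁻¹‖ + ‖avg n y fun w => dirSq w * (conj w)⁻¹‖ +
        3 * ‖t‖ ^ (1 / 2 : ℝ) * avg n y fun w => ‖w‖ ^ (-(3 / 2) : ℝ)) := by
  have hlin := norm_avg_dirSq_sub_sub_le (n := n) hy t
  have hties := (norm_div_ofReal_sub_self_le
    (norm_avg_le (f := fun w => dirSq (w - t)) n fun _ => le_rfl)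
    (avg_norm_dirSq_le_one n y t)).trans (one_sub_avg_norm_dirSq_le hn hy t)
  have hpow : ‖t‖ ^ (3 / 2 : ℝ) = ‖t‖ * ‖t‖ ^ (1 / 2 : ℝ) := by
    rw [← Real.rpow_one_add' (norm_nonneg t) (by norm_num)]
    norm_num
  have htri := norm_sub_le_norm_sub_add_norm_sub (dirSqEst n y t)
    (avg n y fun w => dirSq (w - t)) (avg n y dirSq)
  rw [hpow] at hlin hties
  rw [dirSqEst] at htri ⊢
  linarith

end DirSqEst

/-! ### Limit theorems -/

section CentralLimit

variable {Ω Ω' E : Type*} [NormedAddCommGroup E] [InnerProductSpace ℝ E] [MeasurableSpace E]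
  [BorelSpace E]

theorem charFun_map_eq_charFun_map_inner [SecondCountableTopology E] [MeasurableSpace Ω]
    {P : Measure Ω} {Z : Ω → E} (hZ : AEMeasurable Z P) (t : E) :
    charFun (P.map Z) t = charFun (P.map fun ω => inner ℝ t (Z ω)) 1 := by
  rw [charFun_apply, charFun_apply, integral_map hZ (by fun_prop),
    integral_map hZ.const_inner (by fun_prop)]
  simp [real_inner_comm]

theorem tendstoInDistribution_of_forall_inner [FiniteDimensional ℝ E]
    [MeasurableSpace Ω] [MeasurableSpace Ω'] {P : Measure Ω} [IsProbabilityMeasure P]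
    {P' : Measure Ω'} [IsProbabilityMeasure P'] {X : ℕ → Ω → E} {Z : Ω' → E}
    (hX : ∀ n, AEMeasurable (X n) P) (hZ : AEMeasurable Z P')
    (h : ∀ t, TendstoInDistribution (fun n ω => inner ℝ t (X n ω)) atTop
      (fun ω => inner ℝ t (Z ω)) (fun _ => P) P') :
    TendstoInDistribution X atTop Z (fun _ => P) P' where
  forall_aemeasurable := hX
  aemeasurable_limit := hZ
  tendsto := by
    have := FiniteDimensional.proper ℝ E
    refine ProbabilityMeasure.tendsto_iff_tendsto_charFun.2 fun t => ?_
    have ht := ProbabilityMeasure.tendsto_iff_tendsto_charFun.1 (h t).tendsto 1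
    simpa only [ProbabilityMeasure.coe_mk, charFun_map_eq_charFun_map_inner (hX _),
      charFun_map_eq_charFun_map_inner hZ] using ht

theorem hasLaw_inner_multivariateGaussian {ι : Type*} [Fintype ι] [DecidableEq ι]
    {S : Matrix ι ι ℝ} (hS : S.PosSemidef) (t : EuclideanSpace ℝ ι) :
    HasLaw (fun x => inner ℝ t x)
      (gaussianReal 0 (inner ℝ t (Matrix.toEuclideanCLM (𝕜 := ℝ) S t)).toNNReal)
      (multivariateGaussian 0 S) where
  aemeasurable := by fun_prop
  map_eq := by
    refine (IsGaussian.map_eq_gaussianReal (innerSL ℝ t)).trans ?_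
    rw [ContinuousLinearMap.integral_comp_id_comm IsGaussian.integrable_id,
      integral_id_multivariateGaussian, map_zero, Matrix.inner_toEuclideanCLM,
      ← covarianceBilin_multivariateGaussian (μ := 0) hS,
      covarianceBilin_self IsGaussian.memLp_two_id]
    rfl

theorem tendstoInDistribution_inv_sqrt_smul_sum_sub {ι : Type*} [Fintype ι] [DecidableEq ι]
    [MeasurableSpace Ω] {P : Measure Ω} [IsProbabilityMeasure P] {S : Matrix ι ι ℝ}
    (hS : S.PosSemidef) {X : ℕ → Ω → EuclideanSpace ℝ ι} (hX : MemLp (X 0) 2 P)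
    (hindep : iIndepFun X P) (hident : ∀ i, IdentDistrib (X i) (X 0) P P)
    (hcov : ∀ t : EuclideanSpace ℝ ι, Var[fun ω => inner ℝ t (X 0 ω); P] =
      inner ℝ t (Matrix.toEuclideanCLM (𝕜 := ℝ) S t)) :
    TendstoInDistribution
      (fun (n : ℕ) ω => (√n)⁻¹ • (∑ k ∈ Finset.range n, X k ω - (n : ℝ) • P[X 0])) atTop id
      (fun _ => P) (multivariateGaussian 0 S) := by
  have hmeas (i : ℕ) : AEMeasurable (X i) P := (hident i).aemeasurable_fst
  refine tendstoInDistribution_of_forall_inner (fun n => by fun_prop) aemeasurable_id fun t => ?_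
  have hclt := tendstoInDistribution_inv_sqrt_mul_sum_sub (P := P)
    (X := fun k ω => inner ℝ t (X k ω))
    (by simpa only [hcov t] using hasLaw_inner_multivariateGaussian hS t)
    (hX.const_inner t) (hindep.comp (fun _ x => inner ℝ t x) fun _ => by fun_prop)
    (fun i => (hident i).comp (u := fun x => inner ℝ t x) (by fun_prop))
  simpa only [inner_smul_right, inner_sub_right, inner_sum,
    integral_inner (hX.integrable one_le_two), id] using hclt

end CentralLimit

theorem sqrt_smul_avg {α E : Type*} [NormedAddCommGroup E] [NormedSpace ℝ E] (n : ℕ) (y : ℕ → α)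
    (f : α → E) : √n • avg n y f = (√n)⁻¹ • ∑ i ∈ Finset.range n, f (y i) := by
  rw [avg, smul_smul, ← div_eq_mul_inv, Real.sqrt_div_self']
  simp

section Averages

variable {Ω α E : Type*} [MeasurableSpace Ω] [MeasurableSpace α] {P : Measure Ω} {ν : Measure α}
  {Y : ℕ → Ω → α} [NormedAddCommGroup E]

theorem memLp_comp_of_hasLaw {X : Ω → α} (hX : HasLaw X ν P) {f : α → E} {p : ENNReal}
    (hf : MemLp f p ν) : MemLp (fun ω => f (X ω)) p P := by
  rw [← hX.map_eq] at hf
  exact hf.comp_of_map hX.aemeasurable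

theorem memLp_avg [NormedSpace ℝ E] (hlaw : ∀ i, HasLaw (Y i) ν P) {f : α → E} {p : ENNReal}
    (hf : MemLp f p ν) (n : ℕ) : MemLp (fun ω => avg n (fun i => Y i ω) f) p P := by
  have hsum : MemLp (fun ω => ∑ i ∈ Finset.range n, f (Y i ω)) p P :=
    memLp_finsetSum _ fun i _ => memLp_comp_of_hasLaw (hlaw i) hf
  exact hsum.const_smul (n : ℝ)⁻¹

variable [MeasurableSpace E] [BorelSpace E]

theorem ae_tendsto_avg [NormedSpace ℝ E] [CompleteSpace E] (hlaw : ∀ i, HasLaw (Y i) ν P)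
    (hindep : iIndepFun Y P) {f : α → E} (hf : Measurable f) (hint : Integrable f ν) :
    ∀ᵐ ω ∂P, Tendsto (fun n => avg n (fun i => Y i ω) f) atTop (𝓝 (∫ x, f x ∂ν)) := by
  rw [← (hlaw 0).integral_comp hint.1]
  exact strong_law_ae (fun i ω => f (Y i ω))
    (memLp_one_iff_integrable.1 (memLp_comp_of_hasLaw (hlaw 0) (memLp_one_iff_integrable.2 hint)))
    (fun i j hij => (hindep.indepFun hij).comp hf hf)
    fun i => ((hlaw i).identDistrib (hlaw 0)).comp hf

variable [InnerProductSpace ℝ E] [CompleteSpace E]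

theorem integral_norm_sum_sq {X : ℕ → Ω → E} (hX : ∀ i, MemLp (X i) 2 P)
    [IsProbabilityMeasure P] (hindep : iIndepFun X P) (hmean : ∀ i, P[X i] = 0) (s : Finset ℕ) :
    ∫ ω, ‖∑ i ∈ s, X i ω‖ ^ 2 ∂P = ∑ i ∈ s, ∫ ω, ‖X i ω‖ ^ 2 ∂P := by
  have hint (i j : ℕ) : Integrable (fun ω => inner ℝ (X i ω) (X j ω)) P :=
    ((hX i).norm.integrable_mul (hX j).norm).mono' ((hX i).1.inner (hX j).1)
      (ae_of_all _ fun ω => norm_inner_le_norm _ _)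
  have horth (i j : ℕ) (hij : i ≠ j) : ∫ ω, inner ℝ (X i ω) (X j ω) ∂P = 0 := by
    have h := (hindep.indepFun hij).integral_bilin ((hX i).integrable one_le_two)
      ((hX j).integrable one_le_two) (innerSL ℝ)
    rwa [hmean i, map_zero, zero_apply] at h
  simp_rw [← real_inner_self_eq_norm_sq, sum_inner, inner_sum]
  rw [integral_finsetSum _ fun i _ => integrable_finsetSum _ fun j _ => hint i j]
  refine Finset.sum_congr rfl fun i hi => ?_
  rw [integral_finsetSum _ fun j _ => hint i j]
  exact Finset.sum_eq_single_of_mem i hi fun j _ hji => horth i j hji.symm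

theorem integral_sqrt_mul_norm_avg_sq_le [IsProbabilityMeasure P] (hlaw : ∀ i, HasLaw (Y i) ν P)
    (hindep : iIndepFun Y P) {f : α → E} (hf : Measurable f) (hmem : MemLp f 2 ν)
    (hmean : ∫ x, f x ∂ν = 0) (n : ℕ) :
    ∫ ω, (√n * ‖avg n (fun i => Y i ω) f‖) ^ 2 ∂P ≤ ∫ x, ‖f x‖ ^ 2 ∂ν := by
  have hsq (ω : Ω) : (√n * ‖avg n (fun i => Y i ω) f‖) ^ 2 =
      (n : ℝ)⁻¹ * ‖∑ i ∈ Finset.range n, f (Y i ω)‖ ^ 2 := by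
    rw [← norm_smul_of_nonneg (Real.sqrt_nonneg _), sqrt_smul_avg,
      norm_smul_of_nonneg (by positivity), mul_pow, inv_pow, Real.sq_sqrt n.cast_nonneg]
  have hmean' (i : ℕ) : ∫ ω, f (Y i ω) ∂P = 0 := ((hlaw i).integral_comp hmem.1).trans hmean
  have hsecond (i : ℕ) : ∫ ω, ‖f (Y i ω)‖ ^ 2 ∂P = ∫ x, ‖f x‖ ^ 2 ∂ν :=
    (hlaw i).integral_comp (hmem.1.norm.pow 2)
  simp_rw [hsq]
  rw [integral_const_mul, integral_norm_sum_sq (fun i => memLp_comp_of_hasLaw (hlaw i) hmem)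
    (hindep.comp _ fun _ => hf) hmean']
  simp_rw [hsecond, Finset.sum_const, Finset.card_range, nsmul_eq_mul]
  exact inv_mul_le_of_le_mul₀ n.cast_nonneg (by positivity) le_rfl

theorem integral_sqrt_mul_norm_avg_le [IsProbabilityMeasure P] (hlaw : ∀ i, HasLaw (Y i) ν P)
    (hindep : iIndepFun Y P) {f : α → E} (hf : Measurable f) (hmem : MemLp f 2 ν)
    (hmean : ∫ x, f x ∂ν = 0) (n : ℕ) :
    ∫ ω, √n * ‖avg n (fun i => Y i ω) f‖ ∂P ≤ 1 + ∫ x, ‖f x‖ ^ 2 ∂ν := by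
  have hint : Integrable (fun ω => (√n * ‖avg n (fun i => Y i ω) f‖) ^ 2) P := by
    simp_rw [mul_pow]
    exact (memLp_avg hlaw hmem n).norm.integrable_sq.const_mul _
  calc ∫ ω, √n * ‖avg n (fun i => Y i ω) f‖ ∂P
      ≤ ∫ ω, 1 + (√n * ‖avg n (fun i => Y i ω) f‖) ^ 2 ∂P :=
        integral_mono_of_nonneg (ae_of_all _ fun ω => by positivity)
          ((integrable_const 1).add hint) (ae_of_all _ fun ω => by
            nlinarith [sq_nonneg (√n * ‖avg n (fun i => Y i ω) f‖ - 1)])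
    _ = 1 + ∫ ω, (√n * ‖avg n (fun i => Y i ω) f‖) ^ 2 ∂P := by
        rw [integral_add (integrable_const 1) hint]
        simp
    _ ≤ 1 + ∫ x, ‖f x‖ ^ 2 ∂ν := by
        gcongr
        exact integral_sqrt_mul_norm_avg_sq_le hlaw hindep hf hmem hmean n

end Averages

theorem tendstoInMeasure_zero_of_isLittleO {Ω E : Type*} [MeasurableSpace Ω] {P : Measure Ω}
    [IsProbabilityMeasure P] [NormedAddCommGroup E] {R : ℕ → Ω → E} {B : ℕ → Ω → ℝ} {C : ℝ}
    (hR : ∀ n, AEStronglyMeasurable (R n) P) (hB : ∀ n, Integrable (B n) P)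
    (hB₀ : ∀ n ω, 0 ≤ B n ω) (hBC : ∀ n, ∫ ω, B n ω ∂P ≤ C)
    (hRB : ∀ᵐ ω ∂P, (fun n => R n ω) =o[atTop] fun n => B n ω) :
    TendstoInMeasure P R atTop 0 := by
  have hpos (n : ℕ) (ω : Ω) : 0 < 1 + B n ω := by linarith [hB₀ n ω]
  have hratio : TendstoInMeasure P (fun n ω => ‖R n ω‖ / (1 + B n ω)) atTop 0 := by
    refine tendstoInMeasure_of_tendsto_ae (fun n => ((hR n).norm.aemeasurable.div
      ((hB n).aemeasurable.const_add 1)).aestronglyMeasurable) ?_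
    filter_upwards [hRB] with ω hω
    refine (hω.norm_left.trans_isBigO (.of_norm_le fun n => ?_)).tendsto_div_nhds_zero
    rw [Real.norm_of_nonneg (hB₀ n ω)]
    linarith
  have hmarkov (K : ℝ) (hK : 0 < K) (n : ℕ) : P.real {ω | K ≤ 1 + B n ω} ≤ (1 + C) / K := by
    rw [le_div_iff₀' hK]
    refine (mul_meas_ge_le_integral_of_nonneg (ae_of_all _ fun ω => (hpos n ω).le)
      ((integrable_const 1).add (hB n)) K).trans ?_
    rw [integral_add (integrable_const 1) (hB n)]
    simpa using hBC n
  have hC : 0 < 1 + C := by linarith [(integral_nonneg (hB₀ 0) : 0 ≤ ∫ ω, B 0 ω ∂P), hBC 0]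
  rw [tendstoInMeasure_iff_measureReal_norm] at hratio ⊢
  refine fun δ hδ => tendsto_order.2
    ⟨fun a ha => .of_forall fun n => ha.trans_le measureReal_nonneg, fun ε hε => ?_⟩
  set K := 2 * (1 + C) / ε with hKdef
  have hK : 0 < K := by positivity
  filter_upwards [(hratio (δ / K) (by positivity)).eventually_lt_const (half_pos hε)] with n hn
  have hsub : {ω | δ ≤ ‖R n ω - (0 : Ω → E) ω‖} ⊆
      {ω | δ / K ≤ ‖‖R n ω‖ / (1 + B n ω) - (0 : Ω → ℝ) ω‖} ∪ {ω | K ≤ 1 + B n ω} := by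
    intro ω hω
    refine or_iff_not_imp_right.2 fun hlt => ?_
    simp only [Set.mem_ofPred_eq, not_le, Pi.zero_apply, sub_zero] at hω hlt ⊢
    rw [norm_div, norm_norm, Real.norm_of_nonneg (hpos n ω).le]
    exact div_le_div₀ (norm_nonneg _) hω (hpos n ω) hlt.le
  calc P.real {ω | δ ≤ ‖R n ω - (0 : Ω → E) ω‖}
      ≤ P.real {ω | δ / K ≤ ‖‖R n ω‖ / (1 + B n ω) - (0 : Ω → ℝ) ω‖} +
          P.real {ω | K ≤ 1 + B n ω} := (measureReal_mono hsub).trans (measureReal_union_le _ _)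
    _ < ε / 2 + (1 + C) / K := add_lt_add_of_lt_of_le hn (hmarkov K hK n)
    _ = ε := by rw [hKdef]; field_simp; norm_num

/-! ### Laws of centred observations -/

theorem norm_integral_smul_lt_integral {α E : Type*} [MeasurableSpace α] {ν : Measure α}
    [IsProbabilityMeasure ν] [NormedAddCommGroup E] [NormedSpace ℝ E] [CompleteSpace E]
    [StrictConvexSpace ℝ E] {w : α → ℝ} {f : α → E} (hw : Measurable w) (hint : Integrable w ν)
    (hpos : ∀ x, 0 < w x) (hf : ∀ x, ‖f x‖ ≤ 1) (hlt : ‖∫ x, f x ∂ν‖ < 1) :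
    ‖∫ x, w x • f x ∂ν‖ < ∫ x, w x ∂ν := by
  set κ := ν.withDensity fun x => ENNReal.ofReal (w x) with hκ
  have hfin : IsFiniteMeasure κ := isFiniteMeasure_withDensity_ofReal hint.2
  have hweight : ∫ x, f x ∂κ = ∫ x, w x • f x ∂ν := by
    rw [hκ, integral_withDensity_eq_integral_toReal_smul hw.ennreal_ofReal (by simp)]
    simp only [ENNReal.toReal_ofReal (hpos _).le]
  have hmass : κ.real Set.univ = ∫ x, w x ∂ν := by
    rw [integral_eq_lintegral_of_nonneg_ae (ae_of_all _ fun x => (hpos x).le) hint.1,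
      measureReal_def, hκ, withDensity_apply _ .univ, setLIntegral_univ]
  have hac : ν ≪ κ := withDensity_absolutelyContinuous' hw.ennreal_ofReal.aemeasurable
    (ae_of_all _ fun x => (ENNReal.ofReal_pos.2 (hpos x)).ne')
  rw [← hweight, ← hmass]
  rcases ae_eq_const_or_norm_integral_lt_of_norm_le_const (μ := κ) (ae_of_all _ hf) with h | h
  · have hmean : ∫ x, f x ∂ν = ⨍ x, f x ∂κ := by simp [integral_congr_ae (hac.ae_eq h)]
    have hν : 0 < κ.real Set.univ := by
      rw [hmass, integral_pos_iff_support_of_nonneg (fun x => (hpos x).le) hint]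
      simp [Function.support, (hpos _).ne']
    rw [integral_congr_ae h]
    simp only [Function.const_apply]
    rw [integral_const, norm_smul, ← hmean,
      Real.norm_of_nonneg hν.le]
    exact mul_lt_of_lt_one_right hν hlt
  · rwa [mul_one] at h

theorem inner_sq_eq (u w : ℂ) :
    inner ℝ u w ^ 2 = (‖u‖ ^ 2 * ‖w‖ ^ 2 + (conj u ^ 2 * w ^ 2).re) / 2 := by
  rw [Complex.inner, ← Complex.normSq_eq_norm_sq, ← Complex.normSq_eq_norm_sq,
    Complex.normSq_apply, Complex.normSq_apply]
  simp [sq]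
  ring

/-- The properties of the law `ν` of a centred elliptical observation, in complex coordinates, that
determine the asymptotics of the spatial median and of the spatial sign covariance matrix. The
`k`-th moment of the doubled-angle direction is `q ^ k` for `k = 1, 2`. -/
structure IsDirLaw (ν : Measure ℂ) (q : ℂ) : Prop where
  isProbabilityMeasure : IsProbabilityMeasure ν
  isNegInvariant : ν.IsNegInvariant
  ae_ne_zero : ∀ᵐ z ∂ν, z ≠ 0
  integrable_rpow : Integrable (fun z : ℂ => ‖z‖ ^ (-(3 / 2) : ℝ)) ν
  integral_dirSq : ∫ z, dirSq z ∂ν = q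
  integral_dirSq_sq : ∫ z, dirSq z ^ 2 ∂ν = q ^ 2
  norm_lt_one : ‖q‖ < 1

theorem memLp_dirSq (ν : Measure ℂ) [IsFiniteMeasure ν] (p : ENNReal) : MemLp dirSq p ν :=
  .of_bound measurable_dirSq.aestronglyMeasurable 1 (ae_of_all _ norm_dirSq_le)

theorem memLp_dirSq_sub_const (ν : Measure ℂ) [IsFiniteMeasure ν] (q : ℂ) (p : ENNReal) :
    MemLp (fun z => dirSq z - q) p ν :=
  (memLp_dirSq ν p).sub (memLp_const q)

theorem integrable_dirSq_sub_const_sq (ν : Measure ℂ) [IsFiniteMeasure ν] (q : ℂ) :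
    Integrable (fun z => (dirSq z - q) ^ 2) ν := by
  have hmem := memLp_dirSq_sub_const ν q ⊤
  simpa only [sq, Pi.mul_def] using (hmem.integrable le_top).mul_of_top_right hmem

theorem memLp_dir (ν : Measure ℂ) [IsFiniteMeasure ν] (p : ENNReal) : MemLp dir p ν :=
  .of_bound measurable_dir.aestronglyMeasurable 1 (ae_of_all _ norm_dir_le)

theorem integrable_distWeight (ν : Measure ℂ) [IsFiniteMeasure ν] : Integrable distWeight ν :=
  .of_bound measurable_distWeight.aestronglyMeasurable 1 (ae_of_all _ fun z => by
    rw [Real.norm_of_nonneg (distWeight_pos z).le]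
    exact distWeight_le_one z)

theorem integral_eq_zero_of_odd {ν : Measure ℂ} [ν.IsNegInvariant] {f : ℂ → ℂ}
    (hf : ∀ z, f (-z) = -f z) : ∫ z, f z ∂ν = 0 := by
  have h := integral_neg_eq_self f ν
  simp_rw [hf, integral_neg] at h
  exact self_eq_neg.1 h.symm

namespace IsDirLaw

variable {ν : Measure ℂ} {q : ℂ}

theorem integrable_of_norm_le_inv (h : IsDirLaw ν q) {f : ℂ → ℂ} (hf : Measurable f)
    (hle : ∀ z, ‖f z‖ ≤ ‖z‖⁻¹) : Integrable f ν := by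
  have := h.isProbabilityMeasure
  refine ((integrable_const (1 : ℝ)).add h.integrable_rpow).mono' hf.aestronglyMeasurable ?_
  filter_upwards [h.ae_ne_zero] with z hz
  refine (hle z).trans ?_
  rcases le_or_gt 1 ‖z‖ with hz₁ | hz₁
  · exact (inv_le_one_of_one_le₀ hz₁).trans (le_add_of_nonneg_right (by positivity))
  · rw [← Real.rpow_neg_one]
    exact (Real.rpow_le_rpow_of_exponent_ge (norm_pos_iff.2 hz) hz₁.le (by norm_num)).trans
      (le_add_of_nonneg_left zero_le_one)

theorem norm_integral_distWeight_smul_dirSq_lt (h : IsDirLaw ν q) :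
    ‖∫ z, distWeight z • dirSq z ∂ν‖ < ∫ z, distWeight z ∂ν := by
  have := h.isProbabilityMeasure
  refine norm_integral_smul_lt_integral measurable_distWeight (integrable_distWeight ν)
    distWeight_pos norm_dirSq_le ?_
  rw [h.integral_dirSq]
  exact h.norm_lt_one

theorem integral_dirSq_sub (h : IsDirLaw ν q) : ∫ z, dirSq z - q ∂ν = 0 := by
  have := h.isProbabilityMeasure
  rw [integral_sub ((memLp_dirSq ν 1).integrable le_rfl) (integrable_const _), h.integral_dirSq]
  simp

theorem integral_norm_dirSq_sub_sq (h : IsDirLaw ν q) :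
    ∫ z, ‖dirSq z - q‖ ^ 2 ∂ν = 1 - ‖q‖ ^ 2 := by
  have := h.isProbabilityMeasure
  have hint : Integrable dirSq ν := (memLp_dirSq ν 1).integrable le_rfl
  calc ∫ z, ‖dirSq z - q‖ ^ 2 ∂ν = ∫ z, 1 + ‖q‖ ^ 2 - 2 * inner ℝ q (dirSq z) ∂ν := by
        refine integral_congr_ae ?_
        filter_upwards [h.ae_ne_zero] with z hz
        rw [norm_sub_sq_real, norm_dirSq hz, real_inner_comm]
        ring
    _ = 1 - ‖q‖ ^ 2 := by
        rw [integral_sub (integrable_const _) ((hint.const_inner q).const_mul 2),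
          integral_const_mul, integral_inner hint, h.integral_dirSq, real_inner_self_eq_norm_sq]
        simp
        ring

theorem integral_dirSq_sub_sq (h : IsDirLaw ν q) : ∫ z, (dirSq z - q) ^ 2 ∂ν = 0 := by
  have := h.isProbabilityMeasure
  have hint : Integrable dirSq ν := (memLp_dirSq ν 1).integrable le_rfl
  have hint₂ : Integrable (fun z => dirSq z ^ 2) ν := by
    simpa only [sub_zero] using integrable_dirSq_sub_const_sq ν 0
  have hint₃ : Integrable (fun z => dirSq z ^ 2 - 2 * q * dirSq z) ν := hint₂.sub (hint.const_mul _)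
  calc ∫ z, (dirSq z - q) ^ 2 ∂ν = ∫ z, dirSq z ^ 2 - 2 * q * dirSq z + q ^ 2 ∂ν :=
        integral_congr_ae (ae_of_all _ fun z => by ring)
    _ = 0 := by
        rw [integral_add hint₃ (integrable_const _),
          integral_sub hint₂ (hint.const_mul _), integral_const_mul, h.integral_dirSq,
          h.integral_dirSq_sq]
        simp
        ring

theorem integral_inner_dirSq_sub_sq (h : IsDirLaw ν q) (u : ℂ) :
    ∫ z, inner ℝ u (dirSq z - q) ^ 2 ∂ν = (1 - ‖q‖ ^ 2) / 2 * ‖u‖ ^ 2 := by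
  have := h.isProbabilityMeasure
  have hint : Integrable (fun z => conj u ^ 2 * (dirSq z - q) ^ 2) ν :=
    (integrable_dirSq_sub_const_sq ν q).const_mul _
  have hint_re : Integrable (fun z => (conj u ^ 2 * (dirSq z - q) ^ 2).re) ν := hint.re
  have hre : ∫ z, (conj u ^ 2 * (dirSq z - q) ^ 2).re ∂ν = 0 := by
    refine (integral_re hint).trans ?_
    rw [integral_const_mul, h.integral_dirSq_sub_sq]
    simp
  simp_rw [inner_sq_eq]
  rw [integral_div, integral_add
    ((memLp_dirSq_sub_const ν q 2).norm.integrable_sq.const_mul _) hint_re, integral_const_mul,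
    h.integral_norm_dirSq_sub_sq, hre]
  ring

variable {Ω : Type*} [MeasurableSpace Ω] {P : Measure Ω}

theorem variance_inner_comp_dirSq {E : Type*} [NormedAddCommGroup E] [InnerProductSpace ℝ E]
    [CompleteSpace E] (h : IsDirLaw ν q) {Z : Ω → ℂ} (hZ : HasLaw Z ν P) (L : ℂ →L[ℝ] E) (t : E) :
    Var[fun ω => inner ℝ t (L (dirSq (Z ω))); P] =
      (1 - ‖q‖ ^ 2) / 2 * ‖ContinuousLinearMap.adjoint L t‖ ^ 2 := by
  have := h.isProbabilityMeasure
  have hint : Integrable dirSq ν := (memLp_dirSq ν 1).integrable le_rfl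
  simp_rw [← ContinuousLinearMap.adjoint_inner_left]
  set u := ContinuousLinearMap.adjoint L t
  have hm : Measurable fun z => inner ℝ u (dirSq z) := measurable_dirSq.const_inner
  have hmean : ∫ ω, inner ℝ u (dirSq (Z ω)) ∂P = inner ℝ u q := by
    refine (hZ.integral_comp (f := fun z => inner ℝ u (dirSq z)) hm.aestronglyMeasurable).trans ?_
    rw [integral_inner hint, h.integral_dirSq]
  have hmZ : AEMeasurable (fun ω => inner ℝ u (dirSq (Z ω))) P :=
    hm.comp_aemeasurable hZ.aemeasurable
  rw [variance_eq_integral hmZ, hmean]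
  simp_rw [← inner_sub_right]
  rw [← h.integral_inner_dirSq_sub_sq u]
  exact hZ.integral_comp (f := fun z => inner ℝ u (dirSq z - q) ^ 2)
    (((measurable_dirSq.sub_const q).const_inner).pow_const 2).aestronglyMeasurable

theorem tendstoInDistribution_avg_dirSq {ι : Type*} [Fintype ι] [DecidableEq ι]
    [IsProbabilityMeasure P] (h : IsDirLaw ν q) {Y : ℕ → Ω → ℂ} (hlaw : ∀ i, HasLaw (Y i) ν P)
    (hindep : iIndepFun Y P) {L : ℂ →L[ℝ] EuclideanSpace ℝ ι} {S : Matrix ι ι ℝ}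
    (hS : S.PosSemidef) (hSL : Matrix.toEuclideanCLM (𝕜 := ℝ) S =
      ((1 - ‖q‖ ^ 2) / 2) • L ∘L ContinuousLinearMap.adjoint L) :
    TendstoInDistribution
      (fun (n : ℕ) ω => √n • L (avg n (fun i => Y i ω) fun w => dirSq w - q)) atTop id
      (fun _ => P) (multivariateGaussian 0 S) := by
  have := h.isProbabilityMeasure
  have hm : Measurable fun w => L (dirSq w) := L.continuous.measurable.comp measurable_dirSq
  have hmem : MemLp (fun w => L (dirSq w)) 2 ν := L.comp_memLp' (memLp_dirSq ν 2)
  have hmean : ∫ ω, L (dirSq (Y 0 ω)) ∂P = L q := by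
    refine ((hlaw 0).integral_comp (f := fun w => L (dirSq w)) hm.aestronglyMeasurable).trans ?_
    rw [L.integral_comp_comm ((memLp_dirSq ν 1).integrable le_rfl), h.integral_dirSq]
  have hclt := tendstoInDistribution_inv_sqrt_smul_sum_sub (X := fun i ω => L (dirSq (Y i ω))) hS
    (memLp_comp_of_hasLaw (hlaw 0) hmem) (hindep.comp (fun _ w => L (dirSq w)) fun _ => hm)
    (fun i => ((hlaw i).identDistrib (hlaw 0)).comp hm) fun t => by
      rw [h.variance_inner_comp_dirSq (hlaw 0), hSL, _root_.smul_apply,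
        inner_smul_right, ContinuousLinearMap.comp_apply, ← ContinuousLinearMap.adjoint_inner_left,
        real_inner_self_eq_norm_sq]
  refine hclt.congr (fun n => ae_of_all _ fun ω => ?_) ae_eq_rfl
  beta_reduce
  rw [← map_smul, sqrt_smul_avg, map_smul, map_sum, hmean]
  simp [Finset.sum_sub_distrib, Nat.cast_smul_eq_nsmul]

end IsDirLaw

/-! ### Asymptotics along a sample -/

/-- The almost sure properties of a sequence `y` of centred observations, in complex coordinates,
that make the spatial median negligible in the estimation of the mean doubled-angle direction `q`.
The third and fourth averages are the coefficients of the linear term in the expansion of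
`avg n y fun w => dirSq (w - t)` at `t = 0`. -/
structure IsRegularSample (y : ℕ → ℂ) (q : ℂ) : Prop where
  ne_zero : ∀ i, y i ≠ 0
  exists_le_curvature : ∃ c > 0, ∀ᶠ n in atTop, c ≤ curvature n y
  tendsto_dir : Tendsto (fun n => avg n y dir) atTop (𝓝 0)
  tendsto_inv_conj : Tendsto (fun n => avg n y fun w => (conj w)⁻¹) atTop (𝓝 0)
  tendsto_dirSq_mul_inv_conj : Tendsto (fun n => avg n y fun w => dirSq w * (conj w)⁻¹) atTop (𝓝 0)
  tendsto_dirSq : Tendsto (fun n => avg n y dirSq) atTop (𝓝 q)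
  tendsto_rpow : ∃ m : ℝ, Tendsto (fun n => avg n y fun w => ‖w‖ ^ (-(3 / 2) : ℝ)) atTop (𝓝 m)

theorem IsDirLaw.ae_isRegularSample {Ω : Type*} [MeasurableSpace Ω] {P : Measure Ω}
    {ν : Measure ℂ} {q : ℂ} (h : IsDirLaw ν q) {Y : ℕ → Ω → ℂ} (hlaw : ∀ i, HasLaw (Y i) ν P)
    (hindep : iIndepFun Y P) : ∀ᵐ ω ∂P, IsRegularSample (fun i => Y i ω) q := by
  have := h.isProbabilityMeasure
  have := h.isNegInvariant
  have hne : ∀ᵐ ω ∂P, ∀ i, Y i ω ≠ 0 := ae_all_iff.2 fun i =>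
    ((hlaw i).ae_iff (p := fun z => z ≠ 0) (by fun_prop)).2 h.ae_ne_zero
  have hmconj : Measurable fun w : ℂ => (conj w)⁻¹ := Complex.continuous_conj.measurable.inv
  have hmcurv := measurable_distWeight.smul measurable_dirSq
  have hicurv : Integrable (fun w => distWeight w • dirSq w) ν :=
    (integrable_distWeight ν).smul_of_top_left (memLp_dirSq ν ⊤)
  have hiconj : Integrable (fun w : ℂ => (conj w)⁻¹) ν :=
    h.integrable_of_norm_le_inv hmconj fun z => by rw [norm_inv, Complex.norm_conj]
  have hidirSq : Integrable (fun w : ℂ => dirSq w * (conj w)⁻¹) ν :=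
    h.integrable_of_norm_le_inv (measurable_dirSq.mul hmconj) fun z => by
      rw [norm_mul, norm_inv, Complex.norm_conj]
      exact mul_le_of_le_one_left (by positivity) (norm_dirSq_le z)
  filter_upwards [hne,
    ae_tendsto_avg hlaw hindep measurable_distWeight (integrable_distWeight ν),
    ae_tendsto_avg hlaw hindep hmcurv hicurv,
    ae_tendsto_avg hlaw hindep measurable_dir ((memLp_dir ν 1).integrable le_rfl),
    ae_tendsto_avg hlaw hindep hmconj hiconj,
    ae_tendsto_avg hlaw hindep (measurable_dirSq.mul hmconj) hidirSq,
    ae_tendsto_avg hlaw hindep measurable_dirSq ((memLp_dirSq ν 1).integrable le_rfl),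
    ae_tendsto_avg hlaw hindep (by fun_prop) h.integrable_rpow]
    with ω hne hweight hcurv hdir hconj hdirSqConj hdirSq hrpow
  obtain ⟨c, hc, hlt⟩ := exists_between (sub_pos.2 h.norm_integral_distWeight_smul_dirSq_lt)
  rw [integral_eq_zero_of_odd fun z => by simp [dir, neg_div]] at hdir
  rw [integral_eq_zero_of_odd fun z => by simp] at hconj
  rw [integral_eq_zero_of_odd fun z => by simp [dirSq]] at hdirSqConj
  rw [h.integral_dirSq] at hdirSq
  exact ⟨hne, ⟨c, hc, (hweight.sub hcurv.norm).eventually_const_le hlt⟩, hdir, hconj, hdirSqConj,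
    hdirSq, ⟨_, hrpow⟩⟩

namespace IsRegularSample

variable {y : ℕ → ℂ} {q : ℂ} {t : ℕ → ℂ}

theorem isBigO_spatialMedian (h : IsRegularSample y q)
    (ht : ∀ n u, ∑ i ∈ Finset.range n, ‖y i - t n‖ ≤ ∑ i ∈ Finset.range n, ‖y i - u‖) :
    t =O[atTop] fun n => avg n y dir := by
  obtain ⟨c, hc, hcurv⟩ := h.exists_le_curvature
  have hsmall : ∀ᶠ n in atTop, ‖avg n y dir‖ < c :=
    (tendsto_zero_iff_norm_tendsto_zero.1 h.tendsto_dir).eventually_lt_const hc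
  refine .of_bound c⁻¹ ?_
  filter_upwards [hcurv, hsmall] with n hn hlt
  rw [le_inv_mul_iff₀ hc]
  exact mul_norm_spatialMedian_le h.ne_zero (ht n) hn hlt

theorem tendsto_norm_rpow_mul_avg (h : IsRegularSample y q)
    (ht : t =O[atTop] fun n => avg n y dir) {r : ℝ} (hr : 0 < r) :
    Tendsto (fun n => ‖t n‖ ^ r * avg n y fun w => ‖w‖ ^ (-(3 / 2) : ℝ)) atTop (𝓝 0) := by
  obtain ⟨m, hm⟩ := h.tendsto_rpow
  have hpow := ((ht.trans_tendsto h.tendsto_dir).norm.rpow_const (p := r) (Or.inr hr.le)).mul hm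
  rwa [norm_zero, Real.zero_rpow hr.ne', zero_mul] at hpow

theorem isLittleO_dirSqEst_sub_avg (h : IsRegularSample y q)
    (ht : t =O[atTop] fun n => avg n y dir) :
    (fun n => dirSqEst n y (t n) - avg n y dirSq) =o[atTop] fun n => avg n y dir := by
  have hη : Tendsto (fun n => ‖avg n y fun w => (conj w)⁻¹‖ +
      ‖avg n y fun w => dirSq w * (conj w)⁻¹‖ +
      3 * ‖t n‖ ^ (1 / 2 : ℝ) * avg n y fun w => ‖w‖ ^ (-(3 / 2) : ℝ)) atTop (𝓝 0) := by
    simpa [mul_assoc] using (h.tendsto_inv_conj.norm.add h.tendsto_dirSq_mul_inv_conj.norm).add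
      ((h.tendsto_norm_rpow_mul_avg ht (by norm_num : (0 : ℝ) < 1 / 2)).const_mul 3)
  have hmul := ht.norm_left.mul_isLittleO ((Asymptotics.isLittleO_one_iff ℂ).2 hη)
  simp only [mul_one] at hmul
  refine Asymptotics.IsBigO.trans_isLittleO (.of_bound 1 ?_) hmul
  filter_upwards [eventually_ne_atTop 0] with n hn
  rw [one_mul]
  exact (norm_dirSqEst_sub_avg_le hn h.ne_zero (t n)).trans (Real.le_norm_self _)

theorem tendsto_dirSqEst (h : IsRegularSample y q) (ht : t =O[atTop] fun n => avg n y dir) :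
    Tendsto (fun n => dirSqEst n y (t n)) atTop (𝓝 q) := by
  simpa using ((h.isLittleO_dirSqEst_sub_avg ht).trans_tendsto h.tendsto_dir).add h.tendsto_dirSq

theorem tendsto_avg_norm_dirSq (h : IsRegularSample y q)
    (ht : t =O[atTop] fun n => avg n y dir) :
    Tendsto (fun n => avg n y fun w => ‖dirSq (w - t n)‖) atTop (𝓝 1) := by
  have hlow := (h.tendsto_norm_rpow_mul_avg ht (by norm_num : (0 : ℝ) < 3 / 2)).const_sub 1
  rw [sub_zero] at hlow
  refine tendsto_of_tendsto_of_tendsto_of_le_of_le' hlow tendsto_const_nhds ?_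
    (.of_forall fun n => avg_norm_dirSq_le_one n y (t n))
  filter_upwards [eventually_ne_atTop 0] with n hn
  linarith [one_sub_avg_norm_dirSq_le hn h.ne_zero (t n)]

end IsRegularSample

theorem isLittleO_sub_of_hasFDerivAt {ι E F G : Type*} [NormedAddCommGroup E] [NormedSpace ℝ E]
    [NormedAddCommGroup F] [NormedSpace ℝ F] [SeminormedAddCommGroup G] {l : Filter ι}
    {K : E → F} {L : E →L[ℝ] F} {q : E} (hK : HasFDerivAt K L q) {x m : ι → E} {b : ι → G}
    (hx : Tendsto x l (𝓝 q)) (hxm : (fun i => x i - m i) =o[l] b)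
    (hm : (fun i => m i - q) =O[l] b) :
    (fun i => K (x i) - K q - L (m i - q)) =o[l] b := by
  have hxq : (fun i => x i - q) =O[l] b := by simpa using hxm.isBigO.add hm
  have hL : (fun i => L (x i - m i)) =o[l] b := (L.isBigO_comp _ _).trans_isLittleO hxm
  refine (((hK.isLittleO.comp_tendsto hx).trans_isBigO hxq).add hL).congr_left fun i => ?_
  simp only [Function.comp_apply, map_sub]
  abel

theorem IsRegularSample.isLittleO_sqrt_smul_sub {E : Type*} [NormedAddCommGroup E]
    [NormedSpace ℝ E] {y : ℕ → ℂ} {q : ℂ} {t : ℕ → ℂ} (h : IsRegularSample y q)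
    (ht : t =O[atTop] fun n => avg n y dir) {K : ℂ → E} {L : ℂ →L[ℝ] E} (hK : HasFDerivAt K L q)
    {θ : ℕ → E} (hθ : ∀ᶠ n in atTop, θ n = K (dirSqEst n y (t n))) :
    (fun n : ℕ => √n • (θ n - K q) - √n • L (avg n y fun w => dirSq w - q)) =o[atTop]
      fun n : ℕ => √n * ‖avg n y dir‖ + √n * ‖avg n y fun w => dirSq w - q‖ := by
  have havg : ∀ᶠ n in atTop, (avg n y fun w => dirSq w - q) = avg n y dirSq - q := by
    filter_upwards [eventually_ne_atTop 0] with n hn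
    rw [avg_sub, avg_const hn]
  have hdir : (fun n => avg n y dir) =O[atTop]
      fun n => ‖avg n y dir‖ + ‖avg n y fun w => dirSq w - q‖ :=
    .of_norm_le fun n => le_add_of_nonneg_right (norm_nonneg _)
  have hdirSq : (fun n => avg n y dirSq - q) =O[atTop]
      fun n => ‖avg n y dir‖ + ‖avg n y fun w => dirSq w - q‖ :=
    .congr' (.of_norm_le fun n => le_add_of_nonneg_left (norm_nonneg _)) havg .rfl
  have hdelta := isLittleO_sub_of_hasFDerivAt hK (h.tendsto_dirSqEst ht)
    ((h.isLittleO_dirSqEst_sub_avg ht).trans_isBigO hdir) hdirSq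
  refine ((Asymptotics.isBigO_refl (fun n : ℕ => √(n : ℝ)) atTop).smul_isLittleO hdelta).congr'
    ?_ (.of_forall fun n => mul_add _ _ _)
  filter_upwards [havg, hθ] with n hn hθn
  rw [hn, hθn, smul_sub]

theorem IsDirLaw.tendstoInDistribution_of_eventually_eq {Ω ι : Type*} [MeasurableSpace Ω]
    [Fintype ι] [DecidableEq ι] {P : Measure Ω} [IsProbabilityMeasure P] {ν : Measure ℂ} {q : ℂ}
    (h : IsDirLaw ν q) {Y : ℕ → Ω → ℂ} (hlaw : ∀ i, HasLaw (Y i) ν P) (hindep : iIndepFun Y P)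
    {t : ℕ → Ω → ℂ} (ht : ∀ᵐ ω ∂P, (fun n => t n ω) =O[atTop] fun n => avg n (fun i => Y i ω) dir)
    {K : ℂ → EuclideanSpace ℝ ι} {L : ℂ →L[ℝ] EuclideanSpace ℝ ι} (hK : HasFDerivAt K L q)
    {S : Matrix ι ι ℝ} (hS : S.PosSemidef) (hSL : Matrix.toEuclideanCLM (𝕜 := ℝ) S =
      ((1 - ‖q‖ ^ 2) / 2) • L ∘L ContinuousLinearMap.adjoint L)
    {θ : ℕ → Ω → EuclideanSpace ℝ ι} (hmeas : ∀ n, AEMeasurable (θ n) P)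
    (hθ : ∀ᵐ ω ∂P, ∀ᶠ n in atTop, θ n ω = K (dirSqEst n (fun i => Y i ω) (t n ω))) :
    TendstoInDistribution (fun (n : ℕ) ω => √n • (θ n ω - K q)) atTop id (fun _ => P)
      (multivariateGaussian 0 S) := by
  have := h.isProbabilityMeasure
  have := h.isNegInvariant
  have hclt := h.tendstoInDistribution_avg_dirSq hlaw hindep hS hSL
  have hm (n : ℕ) : AEMeasurable (fun ω => √n • (θ n ω - K q)) P :=
    ((hmeas n).sub_const _).fun_const_smul _
  have hdir (n : ℕ) : Integrable (fun ω => √n * ‖avg n (fun i => Y i ω) dir‖) P :=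
    ((memLp_avg hlaw (memLp_dir ν 1) n).integrable le_rfl).norm.const_mul _
  have hdirSq (n : ℕ) :
      Integrable (fun ω => √n * ‖avg n (fun i => Y i ω) fun w => dirSq w - q‖) P :=
    ((memLp_avg hlaw (memLp_dirSq_sub_const ν q 1) n).integrable le_rfl).norm.const_mul _
  have hdir_le := integral_sqrt_mul_norm_avg_le hlaw hindep measurable_dir (memLp_dir ν 2)
    (integral_eq_zero_of_odd fun z => by simp [dir, neg_div])
  have hdirSq_le := integral_sqrt_mul_norm_avg_le hlaw hindep (measurable_dirSq.sub_const q)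
    (memLp_dirSq_sub_const ν q 2) h.integral_dirSq_sub
  refine tendstoInDistribution_of_tendstoInMeasure_sub _ _ hclt
    (tendstoInMeasure_zero_of_isLittleO
      (fun n => ((hm n).sub (hclt.forall_aemeasurable n)).aestronglyMeasurable)
      (fun n => (hdir n).add (hdirSq n)) (fun n ω => add_nonneg (by positivity) (by positivity))
      (fun n => (integral_add (hdir n) (hdirSq n)).trans_le
        (add_le_add (hdir_le n) (hdirSq_le n))) ?_) hm
  filter_upwards [h.ae_isRegularSample hlaw hindep, ht, hθ] with ω hreg ht hθ
  exact hreg.isLittleO_sqrt_smul_sub ht hK hθ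

/-! ### Elliptical laws in the plane -/

theorem withDensity_comp_map {α β : Type*} [MeasurableSpace α] [MeasurableSpace β] (μ : Measure α)
    {e : α → β} (he : Measurable e) {D : β → ENNReal} (hD : Measurable D) :
    (μ.withDensity fun x => D (e x)).map e = (μ.map e).withDensity D := by
  ext s hs
  rw [Measure.map_apply he hs, withDensity_apply _ (he hs), withDensity_apply _ hs,
    setLIntegral_map hs hD he]

theorem integrable_norm_rpow_neg_withDensity {E : Type*} [NormedAddCommGroup E] [NormedSpace ℝ E]
    [FiniteDimensional ℝ E] [MeasurableSpace E] [BorelSpace E] {μ : Measure E} [μ.IsAddHaarMeasure]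
    {D : E → ℝ} [IsFiniteMeasure (μ.withDensity fun x => ENNReal.ofReal (D x))] {C : ℝ}
    (hC : ∀ᶠ x in 𝓝 0, D x ≤ C) {r : ℝ} (hr : 0 < r) (hrd : r < Module.finrank ℝ E) :
    Integrable (fun x => ‖x‖ ^ (-r)) (μ.withDensity fun x => ENNReal.ofReal (D x)) := by
  obtain ⟨ε, hε, hball⟩ := Metric.eventually_nhds_iff_ball.1 hC
  have hm : Measurable fun x : E => ‖x‖ ^ (-r) := by fun_prop
  have hfinrank : 1 ≤ Module.finrank ℝ E := by
    exact_mod_cast (Nat.cast_pos.1 (hr.trans hrd) : 0 < Module.finrank ℝ E)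
  have hle : (μ.withDensity fun x => ENNReal.ofReal (D x)).restrict (Metric.ball 0 ε) ≤
      ENNReal.ofReal C • μ.restrict (Metric.ball 0 ε) := by
    rw [restrict_withDensity Metric.isOpen_ball.measurableSet, ← withDensity_const]
    refine withDensity_mono ?_
    filter_upwards [ae_restrict_mem Metric.isOpen_ball.measurableSet] with x hx
    exact ENNReal.ofReal_le_ofReal (hball x hx)
  rw [← integrableOn_univ, ← Set.union_compl_self (Metric.ball (0 : E) ε)]
  refine IntegrableOn.union ?_ ?_
  · refine Integrable.mono_measure (Integrable.smul_measure ?_ ENNReal.ofReal_ne_top) hle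
    exact integrableOn_ball_of_norm_le_rpow (C := 1) hfinrank hrd
      (ae_of_all _ fun x => by rw [one_mul, Real.norm_of_nonneg (by positivity)])
      hm.aestronglyMeasurable
  · refine Measure.integrableOn_of_bounded (M := ε ^ (-r)) (measure_ne_top _ _)
      hm.aestronglyMeasurable ?_
    filter_upwards [ae_restrict_mem Metric.isOpen_ball.measurableSet.compl] with x hx
    rw [Real.norm_of_nonneg (by positivity)]
    exact Real.rpow_le_rpow_of_nonpos hε (by simpa using hx) (neg_nonpos.2 hr.le)

theorem integral_circleAverage_comp_mul {E : Type*} [NormedAddCommGroup E] [NormedSpace ℝ E]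
    [CompleteSpace E] {ν : Measure ℂ} [SFinite ν] (hν : ∀ c : ℂ, ‖c‖ = 1 → ν.map (c * ·) = ν)
    {f : ℂ → E} (hf : Integrable f ν) :
    ∫ z, Real.circleAverage (fun ζ => f (ζ * z)) 0 1 ∂ν = ∫ z, f z ∂ν := by
  have hrot (θ : ℝ) : MeasurePreserving (circleMap 0 1 θ * ·) ν ν :=
    ⟨measurable_const_mul _, hν _ (by simp)⟩
  have hshear : MeasurePreserving (fun p : ℝ × ℂ => (p.1, circleMap 0 1 p.1 * p.2))
      ((volume.restrict (Set.Ioc 0 (2 * Real.pi))).prod ν)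
      ((volume.restrict (Set.Ioc 0 (2 * Real.pi))).prod ν) :=
    (MeasurePreserving.id _).skew_product (g := fun θ z => circleMap 0 1 θ * z)
      (by unfold Function.uncurry; fun_prop) (ae_of_all _ fun θ => (hrot θ).map_eq)
  have hint : Integrable (fun p : ℝ × ℂ => f (circleMap 0 1 p.1 * p.2))
      ((volume.restrict (Set.Ioc 0 (2 * Real.pi))).prod ν) :=
    hshear.integrable_comp_of_integrable (hf.comp_snd _)
  have hconst (θ : ℝ) : ∫ z, f (circleMap 0 1 θ * z) ∂ν = ∫ z, f z ∂ν := by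
    have hmap := integral_map (hrot θ).aemeasurable
      (hf.aestronglyMeasurable.mono_measure (hrot θ).map_eq.le)
    rwa [(hrot θ).map_eq, eq_comm] at hmap
  simp_rw [Real.circleAverage_def, intervalIntegral.integral_of_le Real.two_pi_pos.le]
  rw [integral_smul, ← integral_integral_swap hint]
  simp_rw [hconst, setIntegral_const, smul_smul]
  rw [Measure.real, Real.volume_Ioc, sub_zero, ENNReal.toReal_ofReal Real.two_pi_pos.le,
    inv_mul_cancel₀ Real.two_pi_pos.ne', one_smul]

theorem circleAverage_moebius_sq_pow {m s : ℂ} (hm : ‖m‖ < 1) (hs : ‖s‖ = 1) (k : ℕ) :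
    Real.circleAverage (fun ζ => ((ζ ^ 2 * s + m) / (1 + conj m * (ζ ^ 2 * s))) ^ k) 0 1 =
      m ^ k := by
  have hdiff : DiffContOnCl ℂ
      (fun ζ : ℂ => ((ζ ^ 2 * s + m) / (1 + conj m * (ζ ^ 2 * s))) ^ k)
      (Metric.ball 0 |1|) := by
    refine DifferentiableOn.diffContOnCl fun ζ hζ => ?_
    rw [abs_one, closure_ball _ one_ne_zero, mem_closedBall_zero_iff] at hζ
    have hden : 1 + conj m * (ζ ^ 2 * s) ≠ 0 := by
      refine one_add_ne_zero_of_norm_lt_one ?_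
      rw [norm_mul, norm_mul, norm_pow, Complex.norm_conj, hs, mul_one]
      exact (mul_le_of_le_one_right (norm_nonneg m) (pow_le_one₀ (norm_nonneg ζ) hζ)).trans_lt hm
    exact DifferentiableAt.differentiableWithinAt (by fun_prop (disch := assumption))
  simpa using hdiff.circleAverage

/-- The spherical law on `ℂ` with generator `g`. -/
def sphericalLaw (g : ℝ → ℝ) : Measure ℂ :=
  (volume : Measure ℂ).withDensity fun z => ENNReal.ofReal (g (‖z‖ ^ 2))

theorem measurable_density_sphericalLaw {g : ℝ → ℝ} (hg : Measurable g) :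
    Measurable fun z : ℂ => ENNReal.ofReal (g (‖z‖ ^ 2)) := by
  fun_prop

theorem map_mul_sphericalLaw {g : ℝ → ℝ} (hg : Measurable g) {c : ℂ} (hc : ‖c‖ = 1) :
    (sphericalLaw g).map (c * ·) = sphericalLaw g := by
  have hrot : MeasurePreserving (c * ·) (volume : Measure ℂ) volume :=
    (rotation ⟨c, mem_sphere_zero_iff_norm.2 hc⟩).measurePreserving
  have hmap := withDensity_comp_map volume (measurable_const_mul c)
    (measurable_density_sphericalLaw hg)
  simp_rw [norm_mul, hc, one_mul] at hmap
  rw [sphericalLaw, hmap, hrot.map_eq]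

/-- The law of `toComplex (X - μ)` for an elliptical `X` with location `μ`, shape `V` and
generator `g`. -/
def centredLaw (V : Matrix (Fin 2) (Fin 2) ℝ) (g : ℝ → ℝ) : Measure ℂ :=
  (volume : Measure ℂ).withDensity fun z =>
    ENNReal.ofReal (ellipticalDensity 0 V g (toComplex.symm z))

theorem measurable_ellipticalDensity {p : ℕ} (μ : Vec p) (V : Matrix (Fin p) (Fin p) ℝ)
    {g : ℝ → ℝ} (hg : Measurable g) : Measurable (ellipticalDensity μ V g) := by
  unfold ellipticalDensity
  simp only [dotProduct, Matrix.mulVec]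
  fun_prop

theorem ellipticalDensity_sub {p : ℕ} (μ : Vec p) (V : Matrix (Fin p) (Fin p) ℝ) (g : ℝ → ℝ)
    (x : Vec p) : ellipticalDensity 0 V g (x - μ) = ellipticalDensity μ V g x := by
  rw [ellipticalDensity, ellipticalDensity, sub_zero]

theorem measurePreserving_toComplex_sub (μ : Vec 2) :
    MeasurePreserving (fun x : Vec 2 => toComplex (x - μ)) volume volume :=
  toComplex.measurePreserving.comp (measurePreserving_sub_right volume μ)

section CentredLaw

variable {V : Matrix (Fin 2) (Fin 2) ℝ} {g : ℝ → ℝ}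

theorem measurable_density_centredLaw (V : Matrix (Fin 2) (Fin 2) ℝ) (hg : Measurable g) :
    Measurable fun z => ENNReal.ofReal (ellipticalDensity 0 V g (toComplex.symm z)) :=
  ((measurable_ellipticalDensity 0 V hg).comp
    toComplex.symm.continuous.measurable).ennreal_ofReal

theorem IsElliptical.hasLaw_toComplex_sub {F : Measure (Vec 2)} {μ : Vec 2}
    (hF : IsElliptical F μ V g) : HasLaw (fun x => toComplex (x - μ)) (centredLaw V g) F where
  aemeasurable := (measurePreserving_toComplex_sub μ).measurable.aemeasurable
  map_eq := by
    have hmap := withDensity_comp_map volume (measurePreserving_toComplex_sub μ).measurable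
      (measurable_density_centredLaw V hF.measurable_generator)
    simp_rw [LinearIsometryEquiv.symm_apply_apply, ellipticalDensity_sub] at hmap
    rw [hF.eq_withDensity, hmap, (measurePreserving_toComplex_sub μ).map_eq, centredLaw]

theorem isNegInvariant_centredLaw (V : Matrix (Fin 2) (Fin 2) ℝ) (hg : Measurable g) :
    (centredLaw V g).IsNegInvariant where
  neg_eq_self := by
    have hmap := withDensity_comp_map (volume : Measure ℂ) measurable_neg
      (measurable_density_centredLaw V hg)
    have heven (z : ℂ) : ellipticalDensity 0 V g (toComplex.symm (-z)) =
        ellipticalDensity 0 V g (toComplex.symm z) := by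
      simp only [ellipticalDensity, map_neg, sub_zero, WithLp.ofLp_neg, Matrix.mulVec_neg,
        neg_dotProduct, dotProduct_neg, neg_neg]
    simp_rw [heven] at hmap
    rw [Measure.neg, centredLaw, hmap, (Measure.measurePreserving_neg volume).map_eq]

theorem ae_ne_zero_centredLaw (V : Matrix (Fin 2) (Fin 2) ℝ) (g : ℝ → ℝ) :
    ∀ᵐ z ∂centredLaw V g, z ≠ 0 :=
  (withDensity_absolutelyContinuous _ _).ae_le (Measure.ae_ne volume 0)

theorem IsElliptical.isProbabilityMeasure_centredLaw {F : Measure (Vec 2)} {μ : Vec 2}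
    (hF : IsElliptical F μ V g) : IsProbabilityMeasure (centredLaw V g) := by
  have := hF.isProbabilityMeasure
  exact hF.hasLaw_toComplex_sub.isProbabilityMeasure_iff.1 inferInstance

theorem exists_eventually_density_centredLaw_le {μ : Vec 2}
    (hbdd : ∃ C : ℝ, ∀ᶠ x in 𝓝 μ, ellipticalDensity μ V g x ≤ C) :
    ∃ C : ℝ, ∀ᶠ z in 𝓝 0, ellipticalDensity 0 V g (toComplex.symm z) ≤ C := by
  obtain ⟨C, hC⟩ := hbdd
  have hlim : Tendsto (fun z => toComplex.symm z + μ) (𝓝 0) (𝓝 μ) :=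
    Continuous.tendsto' (by fun_prop) _ _ (by simp)
  refine ⟨C, (hlim.eventually hC).mono fun z hz => ?_⟩
  rwa [← ellipticalDensity_sub, add_sub_cancel_right] at hz

/-- The symmetric square root of a positive definite `V`. -/
def sqrtShape (V : Matrix (Fin 2) (Fin 2) ℝ) : Matrix (Fin 2) (Fin 2) ℝ :=
  √(V.trace + 2 * √V.det) • symMatrix 1 (meanDirSq V)

theorem transpose_sqrtShape (V : Matrix (Fin 2) (Fin 2) ℝ) :
    (sqrtShape V).transpose = sqrtShape V := by
  ext i j
  fin_cases i <;> fin_cases j <;> rfl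

theorem sqrtShape_mul_self (hV : V.PosDef) : sqrtShape V * sqrtShape V = V := by
  have hN := trace_add_two_mul_sqrt_det_pos hV
  rw [sqrtShape, symMatrix_meanDirSq hV, smul_mul_smul_comm, smul_mul_smul_comm,
    add_sqrt_det_smul_one_mul_self hV, smul_smul, smul_smul, Real.mul_self_sqrt hN.le]
  field_simp
  rw [one_smul]

theorem abs_det_sqrtShape (hV : V.PosDef) : |(sqrtShape V).det| = √V.det := by
  rw [← Real.sqrt_mul_self_eq_abs, ← Matrix.det_mul, sqrtShape_mul_self hV]

theorem sqrtShape_mul_inv_mul_sqrtShape (hV : V.PosDef) :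
    sqrtShape V * V⁻¹ * sqrtShape V = 1 := by
  have hdet : IsUnit (sqrtShape V).det := by
    rw [isUnit_iff_ne_zero, ← abs_pos, abs_det_sqrtShape hV]
    exact Real.sqrt_pos.2 hV.det_pos
  nth_rewrite 2 [← sqrtShape_mul_self hV]
  rw [Matrix.mul_inv_rev, Matrix.mul_nonsing_inv_cancel_left _ _ hdet,
    Matrix.nonsing_inv_mul _ hdet]

/-- The square root of `V` as a real linear map of `ℂ`. -/
def rootMap (V : Matrix (Fin 2) (Fin 2) ℝ) : ℂ →ₗ[ℝ] ℂ :=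
  (toComplex.toLinearEquiv : Vec 2 →ₗ[ℝ] ℂ) ∘ₗ Matrix.toEuclideanLin (sqrtShape V) ∘ₗ
    (toComplex.toLinearEquiv.symm : ℂ →ₗ[ℝ] Vec 2)

theorem rootMap_apply (V : Matrix (Fin 2) (Fin 2) ℝ) (z : ℂ) :
    rootMap V z = toComplex (WithLp.toLp 2 ((sqrtShape V).mulVec (toComplex.symm z).ofLp)) := rfl

theorem abs_det_rootMap (hV : V.PosDef) : |LinearMap.det (rootMap V)| = √V.det := by
  rw [← abs_det_sqrtShape hV, rootMap, LinearMap.det_conj,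
    Matrix.toEuclideanLin_eq_toLin_orthonormal, LinearMap.det_toLin]

theorem rootMap_eq_smul (V : Matrix (Fin 2) (Fin 2) ℝ) (z : ℂ) :
    rootMap V z = (√(V.trace + 2 * √V.det) / 2) • (z + meanDirSq V * conj z) := by
  obtain ⟨x, rfl⟩ := toComplex.surjective z
  rw [rootMap_apply, LinearIsometryEquiv.symm_apply_apply]
  apply Complex.ext <;>
    simp [toComplex_re, toComplex_im, sqrtShape, symMatrix, Matrix.vecHead, Matrix.vecTail] <;> ring

theorem ellipticalDensity_rootMap (hV : V.PosDef) (g : ℝ → ℝ) (z : ℂ) :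
    ellipticalDensity 0 V g (toComplex.symm (rootMap V z)) = (√V.det)⁻¹ * g (‖z‖ ^ 2) := by
  have hform (x : Fin 2 → ℝ) : (sqrtShape V).mulVec x ⬝ᵥ V⁻¹.mulVec ((sqrtShape V).mulVec x) =
        x ⬝ᵥ x := by
    nth_rewrite 1 [← transpose_sqrtShape V]
    rw [Matrix.mulVec_transpose, ← Matrix.dotProduct_mulVec, Matrix.mulVec_mulVec,
      Matrix.mulVec_mulVec, sqrtShape_mul_inv_mul_sqrtShape hV, Matrix.one_mulVec]
  rw [ellipticalDensity, sub_zero, rootMap_apply, LinearIsometryEquiv.symm_apply_apply, hform,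
    ← toComplex.symm.norm_map z, EuclideanSpace.real_norm_sq_eq]
  simp [dotProduct, sq]

theorem map_rootMap_sphericalLaw (hV : V.PosDef) (hg : Measurable g) :
    (sphericalLaw g).map (rootMap V) = centredLaw V g := by
  have hdet : 0 < √V.det := Real.sqrt_pos.2 hV.det_pos
  have hdet₀ : LinearMap.det (rootMap V) ≠ 0 := by
    rwa [← abs_pos, abs_det_rootMap hV]
  have hvol := Measure.map_linearMap_addHaar_eq_smul_addHaar (volume : Measure ℂ) hdet₀
  rw [abs_inv, abs_det_rootMap hV] at hvol
  have hmap := withDensity_comp_map (volume : Measure ℂ)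
    (LinearMap.continuous_of_finiteDimensional (rootMap V)).measurable
    (measurable_density_centredLaw V hg)
  rw [hvol, withDensity_smul_measure, ← centredLaw] at hmap
  simp_rw [ellipticalDensity_rootMap hV, ENNReal.ofReal_mul (inv_pos.2 hdet).le] at hmap
  have hsmul : ((volume : Measure ℂ).withDensity fun z =>
      ENNReal.ofReal (√V.det)⁻¹ * ENNReal.ofReal (g (‖z‖ ^ 2))) =
      ENNReal.ofReal (√V.det)⁻¹ • sphericalLaw g :=
    withDensity_smul _ (measurable_density_sphericalLaw hg)
  have hcancel : ENNReal.ofReal √V.det * ENNReal.ofReal (√V.det)⁻¹ = 1 := by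
    rw [← ENNReal.ofReal_mul hdet.le, mul_inv_cancel₀ hdet.ne', ENNReal.ofReal_one]
  rw [hsmul, Measure.map_smul] at hmap
  simpa only [smul_smul, hcancel, one_smul] using congrArg (ENNReal.ofReal √V.det • ·) hmap

theorem dirSq_rootMap (hV : V.PosDef) {z : ℂ} (hz : z ≠ 0) :
    dirSq (rootMap V z) =
      (dirSq z + meanDirSq V) / (1 + conj (meanDirSq V) * dirSq z) := by
  have hN : (√(V.trace + 2 * √V.det) / 2 : ℝ) ≠ 0 :=
    (half_pos (Real.sqrt_pos.2 (trace_add_two_mul_sqrt_det_pos hV))).ne'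
  have hz' : conj z ≠ 0 := (map_ne_zero _).2 hz
  rw [rootMap_eq_smul, dirSq, dirSq, Complex.real_smul, map_mul, Complex.conj_ofReal,
    mul_div_mul_left _ _ (Complex.ofReal_ne_zero.2 hN), map_add, map_mul, Complex.conj_conj,
    div_add' _ _ _ hz', mul_div_assoc', add_div' _ _ _ hz', one_mul, div_div_div_cancel_right₀ hz']

theorem circleAverage_dirSq_rootMap_pow (hV : V.PosDef) {z : ℂ} (hz : z ≠ 0) (k : ℕ) :
    Real.circleAverage (fun ζ => dirSq (rootMap V (ζ * z)) ^ k) 0 1 = meanDirSq V ^ k := by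
  rw [← circleAverage_moebius_sq_pow (norm_meanDirSq_lt_one hV) (norm_dirSq hz) k]
  refine Real.circleAverage_congr_sphere fun ζ hζ => ?_
  rw [abs_one, mem_sphere_zero_iff_norm] at hζ
  have hζ₀ : ζ ≠ 0 := norm_ne_zero_iff.1 (by rw [hζ]; exact one_ne_zero)
  rw [dirSq_rootMap hV (mul_ne_zero hζ₀ hz), dirSq_mul, dirSq_of_norm_eq_one hζ]

theorem IsElliptical.integral_dirSq_pow_centredLaw {F : Measure (Vec 2)} {μ : Vec 2}
    (hF : IsElliptical F μ V g) (k : ℕ) :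
    ∫ z, dirSq z ^ k ∂centredLaw V g = meanDirSq V ^ k := by
  have hV := hF.posDef
  have hg := hF.measurable_generator
  have hroot : Measurable (rootMap V) :=
    (LinearMap.continuous_of_finiteDimensional (rootMap V)).measurable
  have hmap := map_rootMap_sphericalLaw hV hg
  have hprob : IsProbabilityMeasure (sphericalLaw g) := by
    have := hF.isProbabilityMeasure_centredLaw
    rw [← hmap] at this
    exact Measure.isProbabilityMeasure_of_map (f := rootMap V)
  have hint : Integrable (fun z => dirSq (rootMap V z) ^ k) (sphericalLaw g) := by
    refine Integrable.of_bound ((measurable_dirSq.comp hroot).pow_const k).aestronglyMeasurable 1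
      (ae_of_all _ fun z => ?_)
    rw [norm_pow]
    exact pow_le_one₀ (norm_nonneg _) (norm_dirSq_le _)
  rw [← hmap, integral_map hroot.aemeasurable (measurable_dirSq.pow_const k).aestronglyMeasurable,
    ← integral_circleAverage_comp_mul (fun c hc => map_mul_sphericalLaw hg hc) hint]
  have hae : ∀ᵐ z ∂sphericalLaw g, z ≠ 0 :=
    (withDensity_absolutelyContinuous _ _).ae_le (Measure.ae_ne volume 0)
  rw [integral_congr_ae (hae.mono fun z hz => circleAverage_dirSq_rootMap_pow hV hz k)]
  simp

theorem IsElliptical.isDirLaw_centredLaw {F : Measure (Vec 2)} {μ : Vec 2}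
    (hF : IsElliptical F μ V g) (hbdd : ∃ C : ℝ, ∀ᶠ x in 𝓝 μ, ellipticalDensity μ V g x ≤ C) :
    IsDirLaw (centredLaw V g) (meanDirSq V) where
  isProbabilityMeasure := hF.isProbabilityMeasure_centredLaw
  isNegInvariant := isNegInvariant_centredLaw V hF.measurable_generator
  ae_ne_zero := ae_ne_zero_centredLaw V g
  integrable_rpow := by
    have := hF.isProbabilityMeasure_centredLaw
    obtain ⟨C, hC⟩ := exists_eventually_density_centredLaw_le hbdd
    have : IsFiniteMeasure ((volume : Measure ℂ).withDensity fun z =>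
        ENNReal.ofReal (ellipticalDensity 0 V g (toComplex.symm z))) :=
      inferInstanceAs (IsFiniteMeasure (centredLaw V g))
    refine integrable_norm_rpow_neg_withDensity hC (by norm_num) ?_
    rw [Complex.finrank_real_complex]
    norm_num
  integral_dirSq := by simpa using hF.integral_dirSq_pow_centredLaw 1
  integral_dirSq_sq := hF.integral_dirSq_pow_centredLaw 2
  norm_lt_one := norm_meanDirSq_lt_one hF.posDef

end CentredLaw

/-! ### The shape estimator -/

theorem dirSq_eq_inv_norm_sq_mul (w : ℂ) : dirSq w = ((‖w‖ ^ 2)⁻¹ : ℝ) * w ^ 2 := by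
  rw [dirSq, div_eq_mul_inv, Complex.inv_def, Complex.conj_conj, Complex.normSq_conj,
    Complex.normSq_eq_norm_sq]
  ring

theorem vecMulVec_self_eq_symMatrix (x : Vec 2) :
    Matrix.vecMulVec x.ofLp x.ofLp = symMatrix (‖toComplex x‖ ^ 2) (toComplex x ^ 2) := by
  rw [← re_sq_add_im_sq, toComplex_re, toComplex_im]
  ext i j
  fin_cases i <;> fin_cases j <;>
    simp [symMatrix, Matrix.vecMulVec_apply, sq, toComplex_re, toComplex_im] <;> ring

theorem signOuter_eq_symMatrix (x : Vec 2) :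
    signOuter x = symMatrix ‖dirSq (toComplex x)‖ (dirSq (toComplex x)) := by
  have hnorm : ‖dirSq (toComplex x)‖ = (‖toComplex x‖ ^ 2)⁻¹ * ‖toComplex x‖ ^ 2 := by
    rw [dirSq_eq_inv_norm_sq_mul, norm_mul, norm_pow, Complex.norm_of_nonneg (by positivity)]
  rw [hnorm, dirSq_eq_inv_norm_sq_mul, symMatrix_smul, ← vecMulVec_self_eq_symMatrix,
    LinearIsometryEquiv.norm_map, signOuter, spatialSign, WithLp.ofLp_smul, Matrix.smul_vecMulVec,
    Matrix.vecMulVec_smul, smul_smul, ← sq, inv_pow]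

theorem symMatrix_avg {α : Type*} (n : ℕ) (y : ℕ → α) (e : α → ℝ) (q : α → ℂ) :
    symMatrix (avg n y e) (avg n y q) = avg n y fun w => symMatrix (e w) (q w) := by
  ext i j
  fin_cases i <;> fin_cases j <;>
    simp [symMatrix, avg, Matrix.sum_apply, ← Finset.sum_div, Finset.sum_add_distrib,
      Finset.sum_sub_distrib] <;> ring

theorem toComplex_sub_sub_toComplex_sub (x t μ : Vec 2) :
    toComplex (x - μ) - toComplex (t - μ) = toComplex (x - t) := by
  rw [← map_sub, sub_sub_sub_cancel_right]

theorem empSSCM_eq_symMatrix (n : ℕ) (x : ℕ → Vec 2) (t μ : Vec 2) :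
    empSSCM n x t =
      symMatrix (avg n (fun i => toComplex (x i - μ)) fun w => ‖dirSq (w - toComplex (t - μ))‖)
        (avg n (fun i => toComplex (x i - μ)) fun w => dirSq (w - toComplex (t - μ))) := by
  simp_rw [symMatrix_avg, avg, toComplex_sub_sub_toComplex_sub, ← signOuter_eq_symMatrix, empSSCM]

theorem shapeEst₀_eq_shape₀ {n : ℕ} {x : ℕ → Vec 2} {t μ : Vec 2}
    (he : 0 < avg n (fun i => toComplex (x i - μ)) fun w => ‖dirSq (w - toComplex (t - μ))‖)
    (hlt : ‖dirSqEst n (fun i => toComplex (x i - μ)) (toComplex (t - μ))‖ < 1) :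
    shapeEst₀ n x t =
      shape₀ (dirSqToParam (dirSqEst n (fun i => toComplex (x i - μ)) (toComplex (t - μ))) 0)
        (dirSqToParam (dirSqEst n (fun i => toComplex (x i - μ)) (toComplex (t - μ))) 1) := by
  rw [dirSqEst, norm_div, Complex.norm_of_nonneg he.le, div_lt_one he] at hlt
  exact diagNormalize_shapeOfSSCM_symMatrix hlt _ (empSSCM_eq_symMatrix n x t μ)

theorem IsSpatialMedian.sum_norm_toComplex_sub_le {n : ℕ} {x : ℕ → Vec 2} {t : Vec 2}
    (ht : IsSpatialMedian n x t) (μ : Vec 2) (u : ℂ) :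
    ∑ i ∈ Finset.range n, ‖toComplex (x i - μ) - toComplex (t - μ)‖ ≤
      ∑ i ∈ Finset.range n, ‖toComplex (x i - μ) - u‖ := by
  obtain ⟨v, rfl⟩ : ∃ v, toComplex (v - μ) = u := ⟨toComplex.symm u + μ, by simp⟩
  simpa only [toComplex_sub_sub_toComplex_sub, LinearIsometryEquiv.norm_map] using ht v

theorem continuousAt_shape₀ {p : ℝ × ℝ} (hp : p.1 ≠ 0) :
    ContinuousAt (fun p : ℝ × ℝ => shape₀ p.1 p.2) p := by
  unfold shape₀
  refine continuousAt_pi.2 fun i => continuousAt_pi.2 fun j => ?_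
  fin_cases i <;> fin_cases j
  · exact continuousAt_fst
  · exact continuousAt_snd
  · exact continuousAt_snd
  · exact continuousAt_fst.inv₀ hp

section RegularSample

variable {V : Matrix (Fin 2) (Fin 2) ℝ} {μ : Vec 2} {x t : ℕ → Vec 2}

theorem IsRegularSample.eventually_shapeEst₀_eq_shape₀ {q : ℂ} (hq : ‖q‖ < 1)
    (h : IsRegularSample (fun i => toComplex (x i - μ)) q)
    (ht : (fun n => toComplex (t n - μ)) =O[atTop]
      fun n => avg n (fun i => toComplex (x i - μ)) dir) :
    ∀ᶠ n in atTop, shapeEst₀ n x (t n) =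
      shape₀ (dirSqToParam (dirSqEst n (fun i => toComplex (x i - μ)) (toComplex (t n - μ))) 0)
        (dirSqToParam (dirSqEst n (fun i => toComplex (x i - μ)) (toComplex (t n - μ))) 1) := by
  filter_upwards [(h.tendsto_avg_norm_dirSq ht).eventually_const_lt one_pos,
    (h.tendsto_dirSqEst ht).norm.eventually_lt_const hq] with n he hlt
  exact shapeEst₀_eq_shape₀ he hlt

theorem IsRegularSample.tendsto_shapeEst₀ (hV : V.PosDef)
    (h : IsRegularSample (fun i => toComplex (x i - μ)) (meanDirSq V))
    (ht : (fun n => toComplex (t n - μ)) =O[atTop]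
      fun n => avg n (fun i => toComplex (x i - μ)) dir) :
    Tendsto (fun n => shapeEst₀ n x (t n)) atTop (𝓝 (shape₀ (ratio V) (corr V))) := by
  have hθ := (hasFDerivAt_dirSqToParam hV).continuousAt.tendsto.comp (h.tendsto_dirSqEst ht)
  rw [dirSqToParam_meanDirSq hV] at hθ
  have hθ (j : Fin 2) := ((EuclideanSpace.proj (𝕜 := ℝ) j).continuous.tendsto _).comp hθ
  refine Tendsto.congr' ?_ ((continuousAt_shape₀ (p := (ratio V, corr V))
    (ratio_pos hV).ne').tendsto.comp ((hθ 0).prodMk_nhds (hθ 1)))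
  filter_upwards [h.eventually_shapeEst₀_eq_shape₀ (norm_meanDirSq_lt_one hV) ht] with n hn
  exact hn.symm

end RegularSample

section Measurability

variable {Ω : Type*} [MeasurableSpace Ω] {P : Measure Ω} {X : ℕ → Ω → Vec 2} {m : Ω → Vec 2}

theorem measurable_signOuter_apply (i j : Fin 2) : Measurable fun x : Vec 2 => signOuter x i j := by
  simp only [signOuter, spatialSign, Matrix.vecMulVec_apply, PiLp.smul_apply, smul_eq_mul]
  fun_prop

theorem measurable_symMatrix_dirSq_apply (i j : Fin 2) :
    Measurable fun z => symMatrix ‖dirSq z‖ (dirSq z) i j := by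
  simpa only [Function.comp_def, signOuter_eq_symMatrix, LinearIsometryEquiv.apply_symm_apply] using
    (measurable_signOuter_apply i j).comp toComplex.symm.continuous.measurable

theorem aemeasurable_empSSCM_apply (hX : ∀ i, AEMeasurable (X i) P) (hm : AEMeasurable m P)
    (n : ℕ) (i j : Fin 2) : AEMeasurable (fun ω => empSSCM n (fun k => X k ω) (m ω) i j) P := by
  simp only [empSSCM, Matrix.smul_apply, Matrix.sum_apply]
  exact (Finset.aemeasurable_fun_sum _ fun k _ =>
    (measurable_signOuter_apply i j).comp_aemeasurable ((hX k).sub hm)).fun_const_smul _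

theorem aemeasurable_shapeEst₀_apply (hX : ∀ i, AEMeasurable (X i) P) (hm : AEMeasurable m P)
    (n : ℕ) (i j : Fin 2) : AEMeasurable (fun ω => shapeEst₀ n (fun k => X k ω) (m ω) i j) P := by
  have h := aemeasurable_empSSCM_apply hX hm n
  simp only [shapeEst₀, shapeEst, shapeOfSSCM_eq, diagNormalize, Matrix.smul_apply,
    Matrix.mul_apply, Fin.sum_univ_two, Matrix.det_fin_two, smul_eq_mul]
  fun_prop (disch := exact h _ _)

end Measurability

section Elliptical

variable {V : Matrix (Fin 2) (Fin 2) ℝ} {g : ℝ → ℝ} {F : Measure (Vec 2)} {μ : Vec 2}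

theorem IsElliptical.sscm_eq_symMatrix (hF : IsElliptical F μ V g) :
    sscm F μ = symMatrix 1 (meanDirSq V) := by
  have := hF.isProbabilityMeasure_centredLaw
  have hint : Integrable dirSq (centredLaw V g) := (memLp_dirSq _ 1).integrable le_rfl
  have hmean : ∫ z, dirSq z ∂centredLaw V g = meanDirSq V := by
    simpa using hF.integral_dirSq_pow_centredLaw 1
  have hre : ∫ z, (dirSq z).re ∂centredLaw V g = (meanDirSq V).re := by
    rw [← hmean]
    exact integral_re hint
  have him : ∫ z, (dirSq z).im ∂centredLaw V g = (meanDirSq V).im := by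
    rw [← hmean]
    exact integral_im hint
  have hone : ∫ z, ‖dirSq z‖ ∂centredLaw V g = 1 := by
    rw [integral_congr_ae ((ae_ne_zero_centredLaw V g).mono fun z hz => norm_dirSq hz)]
    simp
  have hint_re : Integrable (fun z => (dirSq z).re) (centredLaw V g) := hint.re
  have htransfer (i j : Fin 2) : sscm F μ i j =
      ∫ z, symMatrix ‖dirSq z‖ (dirSq z) i j ∂centredLaw V g := by
    simp only [sscm, Matrix.of_apply, signOuter_eq_symMatrix]
    exact hF.hasLaw_toComplex_sub.integral_comp
      (f := fun z => symMatrix ‖dirSq z‖ (dirSq z) i j)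
      (measurable_symMatrix_dirSq_apply i j).aestronglyMeasurable
  ext i j
  rw [htransfer]
  fin_cases i <;> fin_cases j <;>
    simp [symMatrix, integral_div, integral_add hint.norm hint_re, integral_sub hint.norm hint_re,
      hre, him, hone]

variable {Ω : Type*} [MeasurableSpace Ω] {P : Measure Ω} {X m : ℕ → Ω → Vec 2}

theorem IsElliptical.ae_isRegularSample_and_isBigO (hF : IsElliptical F μ V g)
    (hbdd : ∃ C : ℝ, ∀ᶠ x in 𝓝 μ, ellipticalDensity μ V g x ≤ C)
    (hlaw : ∀ i, HasLaw (X i) F P) (hindep : iIndepFun X P)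
    (hm : ∀ n, ∀ᵐ ω ∂P, IsSpatialMedian n (fun i => X i ω) (m n ω)) :
    ∀ᵐ ω ∂P, IsRegularSample (fun i => toComplex (X i ω - μ)) (meanDirSq V) ∧
      (fun n => toComplex (m n ω - μ)) =O[atTop]
        fun n => avg n (fun i => toComplex (X i ω - μ)) dir := by
  filter_upwards [(hF.isDirLaw_centredLaw hbdd).ae_isRegularSample
    (fun i => hF.hasLaw_toComplex_sub.comp (hlaw i))
    (hindep.comp (fun _ x => toComplex (x - μ)) fun _ =>
      (measurePreserving_toComplex_sub μ).measurable), ae_all_iff.2 hm] with ω hreg hmed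
  exact ⟨hreg, hreg.isBigO_spatialMedian fun n u => (hmed n).sum_norm_toComplex_sub_le μ u⟩

theorem IsElliptical.tendstoInDistribution_shapeEst₀ [IsProbabilityMeasure P]
    (hF : IsElliptical F μ V g)
    (hbdd : ∃ C : ℝ, ∀ᶠ x in 𝓝 μ, ellipticalDensity μ V g x ≤ C)
    (hlaw : ∀ i, HasLaw (X i) F P) (hindep : iIndepFun X P) (hm_meas : ∀ n, AEMeasurable (m n) P)
    (hm : ∀ n, ∀ᵐ ω ∂P, IsSpatialMedian n (fun i => X i ω) (m n ω))
    {S : Matrix (Fin 2) (Fin 2) ℝ} (hS : S.PosSemidef)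
    (hSL : Matrix.toEuclideanCLM (𝕜 := ℝ) S = ((1 - ‖meanDirSq V‖ ^ 2) / 2) •
      dirSqToParamDeriv V ∘L ContinuousLinearMap.adjoint (dirSqToParamDeriv V)) :
    TendstoInDistribution
      (fun (n : ℕ) ω => √n • (!₂[shapeEst₀ n (fun i => X i ω) (m n ω) 0 0,
        shapeEst₀ n (fun i => X i ω) (m n ω) 0 1] - !₂[ratio V, corr V]))
      atTop id (fun _ => P) (multivariateGaussian 0 S) := by
  have hreg := hF.ae_isRegularSample_and_isBigO hbdd hlaw hindep hm
  rw [← dirSqToParam_meanDirSq hF.posDef]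
  refine (hF.isDirLaw_centredLaw hbdd).tendstoInDistribution_of_eventually_eq
    (fun i => hF.hasLaw_toComplex_sub.comp (hlaw i))
    (hindep.comp (fun _ x => toComplex (x - μ)) fun _ =>
      (measurePreserving_toComplex_sub μ).measurable) (hreg.mono fun ω h => h.2)
    (hasFDerivAt_dirSqToParam hF.posDef) hS hSL (fun n => ?_) ?_
  · refine (WithLp.measurable_toLp 2 _).comp_aemeasurable (aemeasurable_pi_lambda _ fun i => ?_)
    have hmeas := aemeasurable_shapeEst₀_apply (fun i => (hlaw i).aemeasurable) (hm_meas n) n 0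
    fin_cases i
    · exact hmeas 0
    · exact hmeas 1
  · filter_upwards [hreg] with ω h
    filter_upwards [h.1.eventually_shapeEst₀_eq_shape₀ (norm_meanDirSq_lt_one hF.posDef) h.2]
      with n hn
    rw [hn]
    ext i
    fin_cases i <;> rfl

end Elliptical

end SSCM

end

theorem proposition5 {Ω : Type*} [MeasurableSpace Ω] (P : Measure Ω) [IsProbabilityMeasure P]
    (F : Measure (SSCM.Vec 2)) (μ : SSCM.Vec 2) (V : Matrix (Fin 2) (Fin 2) ℝ) (g : ℝ → ℝ)
    (hF : SSCM.IsElliptical F μ V g)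
    (hbdd : ∃ C : ℝ, ∀ᶠ x in 𝓝 μ, SSCM.ellipticalDensity μ V g x ≤ C)
    (U : Matrix (Fin 2) (Fin 2) ℝ) (l₁ l₂ : ℝ)
    (hU : U ∈ Matrix.orthogonalGroup (Fin 2) ℝ) (hl : l₂ ≤ l₁)
    (hV : V = U * Matrix.diagonal ![l₁, l₂] * U.transpose)
    (X : ℕ → Ω → SSCM.Vec 2) (hX_law : ∀ i, HasLaw (X i) F P) (hX_indep : iIndepFun X P)
    (μhat : ℕ → Ω → SSCM.Vec 2) (hμhat_meas : ∀ n, AEMeasurable (μhat n) P)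
    (hμhat : ∀ n, ∀ᵐ ω ∂P, SSCM.IsSpatialMedian n (fun i => X i ω) (μhat n ω)) :
    (∀ᵐ ω ∂P, Tendsto (fun n => SSCM.shapeEst₀ n (fun i => X i ω) (μhat n ω)) atTop
        (𝓝 (SSCM.shape₀ (SSCM.ratio V) (SSCM.corr V)))) ∧
    (SSCM.WV₀ (SSCM.ratio V) (SSCM.corr V) U l₁ l₂).PosSemidef ∧
    TendstoInDistribution
      (fun (n : ℕ) ω => Real.sqrt n •
        (!₂[SSCM.shapeEst₀ n (fun i => X i ω) (μhat n ω) 0 0,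
            SSCM.shapeEst₀ n (fun i => X i ω) (μhat n ω) 0 1] -
          !₂[SSCM.ratio V, SSCM.corr V]))
      atTop id (fun _ => P)
      (multivariateGaussian 0 (SSCM.WV₀ (SSCM.ratio V) (SSCM.corr V) U l₁ l₂)) ∧
    SSCM.paramToSSCM ![SSCM.ratio V, SSCM.corr V] = ![SSCM.sscm F μ 0 0, SSCM.sscm F μ 0 1] ∧
    ∃ D : Matrix (Fin 2) (Fin 2) ℝ,
      HasFDerivAt SSCM.paramToSSCM (LinearMap.toContinuousLinearMap (Matrix.toLin' D))
        ![SSCM.ratio V, SSCM.corr V] ∧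
      (SSCM.G (SSCM.ratio V) (SSCM.corr V)).submatrix id (Fin.castLE (by norm_num : 2 ≤ 4)) * D
        = 1 := by
  have hVp := hF.posDef
  have ha := SSCM.ratio_pos hVp
  have hρ := SSCM.corr_sq_lt_one hVp
  have hpsd := SSCM.WV₀_posSemidef hVp hU hV (SSCM.ratio V) (SSCM.corr V)
  refine ⟨?_, hpsd, ?_, ?_, SSCM.jacobian (SSCM.ratio V) (SSCM.corr V),
    SSCM.hasFDerivAt_paramToSSCM ha hρ, SSCM.G₂_mul_jacobian ha hρ⟩
  · filter_upwards [hF.ae_isRegularSample_and_isBigO hbdd hX_law hX_indep hμhat] with ω h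
    exact h.1.tendsto_shapeEst₀ hVp h.2
  · exact hF.tendstoInDistribution_shapeEst₀ hbdd hX_law hX_indep hμhat_meas hμhat hpsd
      (SSCM.toEuclideanCLM_WV₀ hVp hU hV)
  · rw [SSCM.paramToSSCM_ratio_corr hVp, hF.sscm_eq_symMatrix]
    rfl
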